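/- Let $\mathfrak g$ be a real Banach Lie algebra (a Banach space with a continuous Lie bracket) with a decomposition $\mathfrak g=\mathfrak g_+\oplus\mathfrak g_-$, as Banach spaces, into two Lie subalgebras. Let $p_\pm$ be the projections, $R=p_+-p_-$, and let $\mathfrak g_R$ be $\mathfrak g$ with the bracket $[x,y]_R=\tfrac12([Rx,y]+[x,Ry])$, which is a Lie bracket. Let $\mathfrak b$ be a Banach space with a non-degenerate continuous bilinear pairing $\langle\cdot,\cdot\rangle:\mathfrak b\times\mathfrak g\to\mathbb R$, so that $\mathfrak b\subset\mathfrak g^*$ and $\mathfrak g\subset\mathfrak b^*$. Suppose that $\mathfrak b$ is a Banach Lie--Poisson space with respect to both $\mathfrak g$ and $\mathfrak g_R$; that is, for each of the two brackets, the coadjoint action $\mathrm{ad}^*_\alpha x=\langle x,[\alpha,\cdot]\rangle$ maps $\mathfrak g\times\mathfrak b$ continuously into $\mathfrak b$. Let $G$ be a Banach Lie group with Lie algebra $\mathfrak g$, and let $G_\pm$ be Banach Lie subgroups of $G$ (Banach Lie groups with an injective smooth immersive homomorphism to $G$) with Lie algebras $\mathfrak g_\pm$. Let $\mathcal A$ be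 the algebra of smooth functions $F:\mathfrak b\to\mathbb R$ with $D_xF\in\mathfrak g\subset\mathfrak b^*$ for all $x\in\mathfrak b$, with the bracket $\{F,K\}_R(x)=\langle x,[D_xF,D_xK]_R\rangle$. For $H\in\mathcal A$, let $X_H=\{\cdot,H\}_R$ be the Hamiltonian vector field: $X_H(x)\in\mathfrak b$ is the vector with $D_xF(X_H(x))=\{F,H\}_R(x)$ for all $F\in\mathcal A$. Put $\mathrm{Ad}^*_g\xi=\xi\circ\mathrm{Ad}_{g^{-1}}$ for $g\in G$ and $\xi\in\mathfrak g^*$. Let $H\in\mathcal A$ be $\mathrm{Ad}^*_G$-invariant: $H(\nu)=H(\mu)$ whenever $\mu,\nu\in\mathfrak b$, $g\in G$ and $\nu=\mathrm{Ad}^*_g\mu$. Let $\mu_0\in\mathfrak b$. Then the factorization problem $$\exp(-t\,D_{\mu_0}H)=g_+(t)^{-1}g_-(t),\qquad g_\pm(0)=e,$$ has a solution by smooth curves $g_\pm(t)\in G_\pm$ for $t$ in some open interval around $0$. Moreover, for every open interval $J\ni 0$ and all smooth curves $g_\pm:J\to G_\pm$ solving the factorization problem on $J$, the functionals $\mathrm{Ad}^*_{g_+(t)}\mu_0$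 and $\mathrm{Ad}^*_{g_-(t)}\mu_0$ lie in $\mathfrak b$ and coincide for all $t\in J$, and $$\mu(t)=\mathrm{Ad}^*_{g_+(t)}\mu_0=\mathrm{Ad}^*_{g_-(t)}\mu_0,\qquad t\in J,$$ is an integral curve of $X_H$ with $\mu(0)=\mu_0$. The map $t\mapsto D_{\mu(t)}H\in\mathfrak g$ is continuous on $J$, and $\mu$ is the only integral curve $\nu:J\to\mathfrak b$ of $X_H$ with $\nu(0)=\mu_0$ along which $t\mapsto D_{\nu(t)}H\in\mathfrak g$ is continuous. -/

import Mathlib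

open Set
open scoped Manifold ContDiff

noncomputable section

/-! ### Banach Lie algebras and `R`-matrices -/

/-- A Banach Lie algebra structure on a real Banach space `𝔤`: a continuous bilinear alternating
bracket satisfying the Jacobi identity. -/
structure BanachLieBracket (𝔤 : Type*) [NormedAddCommGroup 𝔤] [NormedSpace ℝ 𝔤] where
  /-- the bracket, as a continuous bilinear map -/
  br : 𝔤 →L[ℝ] 𝔤 →L[ℝ] 𝔤
  self : ∀ x, br x x = 0
  jacobi : ∀ x y z, br (br x y) z + br (br y z) x + br (br z x) y = 0

section Algebra

variable {𝔤 : Type*} [NormedAddCommGroup 𝔤] [NormedSpace ℝ 𝔤]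

theorem BanachLieBracket.skew (L : BanachLieBracket 𝔤) (x y : 𝔤) : L.br x y = -L.br y x := by
  have h := L.self (x + y)
  simp only [map_add, add_apply, L.self, zero_add, add_zero] at h
  exact eq_neg_of_add_eq_zero_right h

/-- A subspace that is a Lie subalgebra. -/
def BanachLieBracket.IsSubalgebra (L : BanachLieBracket 𝔤) (𝔥 : Submodule ℝ 𝔤) : Prop :=
  ∀ x ∈ 𝔥, ∀ y ∈ 𝔥, L.br x y ∈ 𝔥

/-- `[x, y]_R = ½ ([R x, y] + [x, R y])`, as a continuous bilinear map. -/
def BanachLieBracket.rBilin (L : BanachLieBracket 𝔤) (R : 𝔤 →L[ℝ] 𝔤) : 𝔤 →L[ℝ] 𝔤 →L[ℝ] 𝔤 :=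
  (1 / 2 : ℝ) • (L.br.comp R + L.br.bilinearComp (ContinuousLinearMap.id ℝ 𝔤) R)

theorem BanachLieBracket.rBilin_apply (L : BanachLieBracket 𝔤) (R : 𝔤 →L[ℝ] 𝔤) (x y : 𝔤) :
    L.rBilin R x y = (1 / 2 : ℝ) • (L.br (R x) y + L.br x (R y)) := by
  simp [BanachLieBracket.rBilin]

/-- A classical `R`-matrix: a bounded operator `R` for which `[·,·]_R` is a Lie bracket
(skew-symmetry being automatic). -/
def BanachLieBracket.IsRMatrix (L : BanachLieBracket 𝔤) (R : 𝔤 →L[ℝ] 𝔤) : Prop :=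
  ∀ x y z, L.rBilin R (L.rBilin R x y) z + L.rBilin R (L.rBilin R y z) x
    + L.rBilin R (L.rBilin R z x) y = 0

/-- The Banach Lie algebra `𝔤_R`. -/
def BanachLieBracket.withR (L : BanachLieBracket 𝔤) (R : 𝔤 →L[ℝ] 𝔤) (hR : L.IsRMatrix R) :
    BanachLieBracket 𝔤 where
  br := L.rBilin R
  self x := by rw [L.rBilin_apply, L.skew x (R x), add_neg_cancel, smul_zero]
  jacobi := hR

/-- A decomposition `𝔤 = 𝔤p ⊕ 𝔤m`, as Banach spaces, into two Lie subalgebras (which are then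
closed, as topological complements); `𝔤p` plays the role of `𝔤₊` and `𝔤m` that of `𝔤₋`. -/
structure BanachLieBracket.IsSplitting (L : BanachLieBracket 𝔤) (𝔤p 𝔤m : Submodule ℝ 𝔤) :
    Prop where
  compl : 𝔤p.IsTopCompl 𝔤m
  pos : L.IsSubalgebra 𝔤p
  neg : L.IsSubalgebra 𝔤m

variable {L : BanachLieBracket 𝔤} {𝔤p 𝔤m : Submodule ℝ 𝔤}

/-- The operator `R = p₊ - p₋` of a decomposition `𝔤 = 𝔤p ⊕ 𝔤m`. -/
def BanachLieBracket.IsSplitting.R (h : L.IsSplitting 𝔤p 𝔤m) : 𝔤 →L[ℝ] 𝔤 :=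
  𝔤p.projectionL 𝔤m h.compl - 𝔤m.projectionL 𝔤p h.compl.symm

theorem BanachLieBracket.IsSplitting.rBilin_R (h : L.IsSplitting 𝔤p 𝔤m) (x y : 𝔤) :
    L.rBilin h.R x y =
      L.br (𝔤p.projectionL 𝔤m h.compl x) (𝔤p.projectionL 𝔤m h.compl y)
        - L.br (𝔤m.projectionL 𝔤p h.compl.symm x) (𝔤m.projectionL 𝔤p h.compl.symm y) := by
  have e (z : 𝔤) : z = 𝔤p.projectionL 𝔤m h.compl z + 𝔤m.projectionL 𝔤p h.compl.symm z := by
    simpa using (Submodule.projection_add_projection_eq_self h.compl.isCompl z).symm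
  rw [L.rBilin_apply, BanachLieBracket.IsSplitting.R]
  simp only [sub_apply]
  generalize hp : 𝔤p.projectionL 𝔤m h.compl = p at *
  generalize hm : 𝔤m.projectionL 𝔤p h.compl.symm = m at *
  have e1 : L.br (p x - m x) y = L.br (p x - m x) (p y + m y) := by rw [← e y]
  have e2 : L.br x (p y - m y) = L.br (p x + m x) (p y - m y) := by rw [← e x]
  rw [e1, e2]
  simp only [map_add, map_sub, add_apply, sub_apply]
  module

/-- The operator `R = p₊ - p₋` is a classical `R`-matrix. -/
theorem BanachLieBracket.IsSplitting.isRMatrix (h : L.IsSplitting 𝔤p 𝔤m) : L.IsRMatrix h.R := by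
  have hp (x y : 𝔤) : 𝔤p.projectionL 𝔤m h.compl (L.rBilin h.R x y) =
      L.br (𝔤p.projectionL 𝔤m h.compl x) (𝔤p.projectionL 𝔤m h.compl y) := by
    rw [h.rBilin_R, map_sub,
      Submodule.projectionL_apply_left h.compl ⟨_, h.pos _
        (Submodule.projectionL_apply_mem h.compl x) _
        (Submodule.projectionL_apply_mem h.compl y)⟩,
      Submodule.projectionL_apply_right h.compl ⟨_, h.neg _
        (Submodule.projectionL_apply_mem h.compl.symm x) _
        (Submodule.projectionL_apply_mem h.compl.symm y)⟩, sub_zero]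
  have hm (x y : 𝔤) : 𝔤m.projectionL 𝔤p h.compl.symm (L.rBilin h.R x y) =
      -L.br (𝔤m.projectionL 𝔤p h.compl.symm x) (𝔤m.projectionL 𝔤p h.compl.symm y) := by
    rw [h.rBilin_R, map_sub,
      Submodule.projectionL_apply_right h.compl.symm ⟨_, h.pos _
        (Submodule.projectionL_apply_mem h.compl x) _
        (Submodule.projectionL_apply_mem h.compl y)⟩,
      Submodule.projectionL_apply_left h.compl.symm ⟨_, h.neg _
        (Submodule.projectionL_apply_mem h.compl.symm x) _
        (Submodule.projectionL_apply_mem h.compl.symm y)⟩, zero_sub]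
  intro x y z
  rw [h.rBilin_R (L.rBilin h.R x y), h.rBilin_R (L.rBilin h.R y z), h.rBilin_R (L.rBilin h.R z x)]
  simp only [hp, hm, map_neg, neg_apply, sub_neg_eq_add]
  have j1 := L.jacobi (𝔤p.projectionL 𝔤m h.compl x) (𝔤p.projectionL 𝔤m h.compl y)
    (𝔤p.projectionL 𝔤m h.compl z)
  have j2 := L.jacobi (𝔤m.projectionL 𝔤p h.compl.symm x) (𝔤m.projectionL 𝔤p h.compl.symm y)
    (𝔤m.projectionL 𝔤p h.compl.symm z)
  rw [← add_zero (0 : 𝔤)]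
  nth_rewrite 1 [← j1]
  rw [← j2]
  abel

end Algebra

/-! ### Banach Lie--Poisson spaces -/

section LiePoisson

variable {𝔤 : Type*} [NormedAddCommGroup 𝔤] [NormedSpace ℝ 𝔤]
  {𝔟 : Type*} [NormedAddCommGroup 𝔟] [NormedSpace ℝ 𝔟]

/-- A duality pairing between `𝔟` and `𝔤`: a continuous bilinear form that is non-degenerate, i.e.
induces injections of `𝔟` into the dual of `𝔤` and of `𝔤` into the dual of `𝔟`. -/
structure IsDualityPairing (B : 𝔟 →L[ℝ] 𝔤 →L[ℝ] ℝ) : Prop where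
  injective_left : Function.Injective B
  injective_right : Function.Injective B.flip

/-- `𝔟`, paired with `𝔤` by `B`, is a Banach Lie--Poisson space with respect to the Banach Lie
algebra `(𝔤, L)`: the coadjoint action `ad*_α x = ⟨x, [α, ·]⟩` maps `𝔤 × 𝔟` continuously to `𝔟`. -/
structure IsBanachLiePoisson (B : 𝔟 →L[ℝ] 𝔤 →L[ℝ] ℝ) (L : BanachLieBracket 𝔤) : Prop where
  pairing : IsDualityPairing B
  coad : ∃ adStar : 𝔤 → 𝔟 → 𝔟, (∀ α x, B (adStar α x) = (B x).comp (L.br α)) ∧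
    Continuous (fun p : 𝔤 × 𝔟 => adStar p.1 p.2)

/-- The algebra `𝒜` of smooth functions on `𝔟` with differentials in `𝔤 ⊂ 𝔟*`. -/
def admissibleFunctions (B : 𝔟 →L[ℝ] 𝔤 →L[ℝ] ℝ) : Set (𝔟 → ℝ) :=
  {F | ContDiff ℝ ∞ F ∧ ∀ x, ∃ X : 𝔤, fderiv ℝ F x = B.flip X}

/-- The differential `D_x F` of a function `F ∈ 𝒜`, as an element of `𝔤`. -/
def diffAt (B : 𝔟 →L[ℝ] 𝔤 →L[ℝ] ℝ) (F : 𝔟 → ℝ) (x : 𝔟) : 𝔤 :=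
  Classical.epsilon fun X => fderiv ℝ F x = B.flip X

theorem fderiv_eq_diffAt {B : 𝔟 →L[ℝ] 𝔤 →L[ℝ] ℝ} {F : 𝔟 → ℝ} (hF : F ∈ admissibleFunctions B)
    (x : 𝔟) : fderiv ℝ F x = B.flip (diffAt B F x) :=
  Classical.epsilon_spec (hF.2 x)

/-- The Lie--Poisson bracket `{F, G}(x) = ⟨x, [D_x F, D_x G]⟩` of the Banach Lie algebra
`(𝔤, L)`. -/
def poissonBracket (B : 𝔟 →L[ℝ] 𝔤 →L[ℝ] ℝ) (L : BanachLieBracket 𝔤) (F G : 𝔟 → ℝ) (x : 𝔟) : ℝ :=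
  B x (L.br (diffAt B F x) (diffAt B G x))

/-- The Hamiltonian vector field `X_H = {·, H}`: the vector `X_H(x) ∈ 𝔟` such that
`D_x F (X_H(x)) = {F, H}(x)` for all `F ∈ 𝒜`. -/
def hamiltonianField (B : 𝔟 →L[ℝ] 𝔤 →L[ℝ] ℝ) (L : BanachLieBracket 𝔤) (H : 𝔟 → ℝ) (x : 𝔟) : 𝔟 :=
  Classical.epsilon fun v => ∀ F ∈ admissibleFunctions B, fderiv ℝ F x v = poissonBracket B L F H x

theorem linear_mem_admissibleFunctions (B : 𝔟 →L[ℝ] 𝔤 →L[ℝ] ℝ) (Y : 𝔤) :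
    (fun x => B x Y) ∈ admissibleFunctions B :=
  ⟨(B.flip Y).contDiff, fun _ => ⟨Y, (B.flip Y).fderiv⟩⟩

/-- On a Banach Lie--Poisson space the Hamiltonian vector field exists, is unique, and equals
`-ad*_{D_x H} x`. -/
theorem hamiltonianField_spec {B : 𝔟 →L[ℝ] 𝔤 →L[ℝ] ℝ} {L : BanachLieBracket 𝔤}
    (h : IsBanachLiePoisson B L) (H : 𝔟 → ℝ) (x : 𝔟) :
    (∀ F ∈ admissibleFunctions B,
      fderiv ℝ F x (hamiltonianField B L H x) = poissonBracket B L F H x) ∧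
    ∀ Y, B (hamiltonianField B L H x) Y = -B x (L.br (diffAt B H x) Y) := by
  obtain ⟨a, ha, -⟩ := h.coad
  have key : ∀ F ∈ admissibleFunctions B,
      fderiv ℝ F x (hamiltonianField B L H x) = poissonBracket B L F H x := by
    refine Classical.epsilon_spec
      (p := fun v => ∀ F ∈ admissibleFunctions B, fderiv ℝ F x v = poissonBracket B L F H x)
      ⟨-a (diffAt B H x) x, fun F hF => ?_⟩
    rw [fderiv_eq_diffAt hF x, map_neg, ContinuousLinearMap.flip_apply, ha,
      ContinuousLinearMap.comp_apply, poissonBracket, L.skew (diffAt B F x), map_neg]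
  refine ⟨key, fun Y => ?_⟩
  have hY := linear_mem_admissibleFunctions B Y
  have e : fderiv ℝ (fun x => B x Y) x = B.flip Y := (B.flip Y).fderiv
  have e' : diffAt B (fun x => B x Y) x = Y :=
    h.pairing.injective_right ((fderiv_eq_diffAt hY x).symm.trans e)
  have k := key _ hY
  rw [poissonBracket, e', e, L.skew Y, map_neg] at k
  exact k

end LiePoisson

/-! ### Banach Lie groups -/

section Group

variable {E : Type*} [NormedAddCommGroup E] [NormedSpace ℝ E]
  {G : Type*} [TopologicalSpace G] [ChartedSpace E G] [Group G]

/-- The adjoint action `Ad_g`: the derivative at `1` of `x ↦ g x g⁻¹`. -/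
def adjointAction (g : G) :
    GroupLieAlgebra 𝓘(ℝ, E) G →L[ℝ] GroupLieAlgebra 𝓘(ℝ, E) G :=
  mfderiv 𝓘(ℝ, E) 𝓘(ℝ, E) (fun x : G => g * x * g⁻¹) 1

/-- The exponential map: `exp X = γ(1)`, where `γ` is the integral curve through `1` of the
left-invariant vector field defined by `X` (equivalently, the one-parameter subgroup with
velocity `X`). -/
def lieExp (X : GroupLieAlgebra 𝓘(ℝ, E) G) : G :=
  Classical.epsilon (fun γ : ℝ → G =>
    γ 0 = 1 ∧ IsMIntegralCurve (I := 𝓘(ℝ, E)) γ (mulInvariantVectorField X)) 1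

/-- The linear homeomorphism `φ` identifies the Banach Lie algebra `(𝔤, L)` with the Lie algebra
of the Banach Lie group `G`. -/
def IsLieAlgebraIso {𝔤 : Type*} [NormedAddCommGroup 𝔤] [NormedSpace ℝ 𝔤]
    (L : BanachLieBracket 𝔤) (φ : 𝔤 ≃L[ℝ] GroupLieAlgebra 𝓘(ℝ, E) G) : Prop :=
  ∀ x y, φ (L.br x y) = ⁅φ x, φ y⁆

/-- The injective smooth immersive homomorphism `ι` makes the Banach Lie group `K` a (not
necessarily embedded) Banach Lie subgroup of `G` whose Lie algebra is the subspace of `Lie(G)`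
corresponding to `𝔥 ⊂ 𝔤` under `φ`. -/
structure IsLieSubgroup {𝔤 : Type*} [NormedAddCommGroup 𝔤] [NormedSpace ℝ 𝔤]
    (φ : 𝔤 ≃L[ℝ] GroupLieAlgebra 𝓘(ℝ, E) G) (𝔥 : Submodule ℝ 𝔤)
    (E' : Type*) [NormedAddCommGroup E'] [NormedSpace ℝ E']
    {K : Type*} [TopologicalSpace K] [ChartedSpace E' K] [Group K] (ι : K →* G) : Prop where
  injective : Function.Injective ι
  smooth : ContMDiff 𝓘(ℝ, E') 𝓘(ℝ, E) ∞ ι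
  immersion : Function.Injective (mfderiv 𝓘(ℝ, E') 𝓘(ℝ, E) ι 1)
  range : Set.range (mfderiv 𝓘(ℝ, E') 𝓘(ℝ, E) ι 1) = φ '' 𝔥

variable {𝔤 : Type*} [NormedAddCommGroup 𝔤] [NormedSpace ℝ 𝔤]
  {𝔟 : Type*} [NormedAddCommGroup 𝔟] [NormedSpace ℝ 𝔟]

/-- The adjoint action of `G` on `𝔤`, via the identification `φ` of `𝔤` with `Lie(G)`. -/
def Ad (φ : 𝔤 ≃L[ℝ] GroupLieAlgebra 𝓘(ℝ, E) G) (g : G) : 𝔤 →L[ℝ] 𝔤 :=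
  (φ.symm : GroupLieAlgebra 𝓘(ℝ, E) G →L[ℝ] 𝔤).comp
    ((adjointAction g).comp (φ : 𝔤 →L[ℝ] GroupLieAlgebra 𝓘(ℝ, E) G))

/-- The coadjoint action of `G` on `𝔤*`: `Ad*_g ξ = ξ ∘ Ad_{g⁻¹}`. -/
def coAd (φ : 𝔤 ≃L[ℝ] GroupLieAlgebra 𝓘(ℝ, E) G) (g : G) (ξ : 𝔤 →L[ℝ] ℝ) : 𝔤 →L[ℝ] ℝ :=
  ξ.comp (Ad φ g⁻¹)

/-- `H : 𝔟 → ℝ` is `Ad*_G`-invariant: `H(ν) = H(μ)` whenever `μ, ν ∈ 𝔟` and `ν = Ad*_g μ` under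
the injection `𝔟 ⊂ 𝔤*`. -/
def IsCoAdInvariant (B : 𝔟 →L[ℝ] 𝔤 →L[ℝ] ℝ) (φ : 𝔤 ≃L[ℝ] GroupLieAlgebra 𝓘(ℝ, E) G)
    (H : 𝔟 → ℝ) : Prop :=
  ∀ (g : G) (μ ν : 𝔟), B ν = coAd φ g (B μ) → H ν = H μ

/-- The curves `gp` in `K` and `gm` in `K'` are smooth on `J` and solve there the factorization
problem `exp(t X) = gp(t)⁻¹ gm(t)`, `gp(0) = gm(0) = e`. -/
structure IsFactorization (E₁ E₂ : Type*) {K₁ K₂ : Type*}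
    [NormedAddCommGroup E₁] [NormedSpace ℝ E₁] [NormedAddCommGroup E₂] [NormedSpace ℝ E₂]
    [TopologicalSpace K₁] [ChartedSpace E₁ K₁] [Group K₁]
    [TopologicalSpace K₂] [ChartedSpace E₂ K₂] [Group K₂]
    (ι₁ : K₁ →* G) (ι₂ : K₂ →* G) (X : GroupLieAlgebra 𝓘(ℝ, E) G) (J : Set ℝ)
    (gp : ℝ → K₁) (gm : ℝ → K₂) : Prop where
  smooth_pos : ContMDiffOn 𝓘(ℝ, ℝ) 𝓘(ℝ, E₁) ∞ gp J
  smooth_neg : ContMDiffOn 𝓘(ℝ, ℝ) 𝓘(ℝ, E₂) ∞ gm J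
  init_pos : gp 0 = 1
  init_neg : gm 0 = 1
  factor : ∀ t ∈ J, lieExp (t • X) = (ι₁ (gp t))⁻¹ * ι₂ (gm t)

end Group

end

/-!
The integral curves of an invariant Hamiltonian are coadjoint orbits of the factors of
`exp(-t D_{μ₀}H)`. Three differential equations carry the argument, all of them linear once the
right velocity of the curve in the group is known.

*The adjoint action.* Say that a curve `γ` in `G` has right velocity `a` if `γ' = a γ`. Then
`w(t) = Ad_{γ(t)} y` satisfies `w' = [a, w]` (`HasRightVelocity.hasDerivAt_chartAd`). This is a
computation in the chart at the identity: conjugation is jointly smooth, and differentiating the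
relation between left and right translations gives the derivative of `g ↦ Ad_g y` at the identity
as the bracket of left-invariant vector fields (`hasFDerivAt_chartAd_symm`,
`bracket_eq_chartBracket`).

*The coadjoint action on `𝔟`.* The predual `𝔟` is not assumed to be invariant under `Ad*_G`. But
`-ad*` is a bounded bilinear map from `𝔤 × 𝔟` to `𝔟`, so the equation `u' = -ad*_{a(t)} u` has a
propagator `U(t)` by bijections of `𝔟` (`exists_isCoadjointFlow`). The pairing of a solution in `𝔟`
with a solution of `w' = [a, w]` in `𝔤` is constant, so `U(t) x = Ad*_{γ(t)} x`, which therefore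
lies in `𝔟` (`IsCoadjointFlow.eq_coAd`). In particular, an `Ad*_G`-invariant `H` satisfies
`⟨x, [X, D_x H]⟩ = 0` for all `X`
(`IsCoAdInvariant.isInfinitesimallyInvariant`). Conversely such an `H` is constant along coadjoint
flows, and differentiating `H ∘ U(t) = H` gives the equivariance
`D_{μ(t)}H = Ad_{γ(t)} D_{μ₀}H` for `μ(t) = U(t) μ₀` (`IsCoadjointFlow.diffAt_eq`).

*Factorization and integral curves.* Let `a` and `b` be the right velocities of `g₊` and `g₋`.
Differentiating `g₋ = g₊ exp(-t D_{μ₀}H)` gives `Ad_{g₊} D_{μ₀}H = a - b` with `a ∈ 𝔤₊` and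
`b ∈ 𝔤₋`, so `a = p₊ D_μ H` along `μ = Ad*_{g₊} μ₀`. By infinitesimal invariance,
`X_H(x) = -ad*_{p₊ D_x H} x` (`hamiltonianField_withR`), so `μ' = -ad*_a μ` says that `μ` is an
integral curve. The orbits of `g₊` and `g₋` coincide because `exp(-t D_{μ₀}H)` fixes `μ₀`.

*Uniqueness.* Along any integral curve `ν` on which `M = D_ν H` is continuous, `ν` is a trajectory
of the coadjoint flow of `p₊ M`, so equivariance gives the Lax equation `M' = [p₊ M, M]`. This
equation in `𝔤` is locally Lipschitz and determines `M`; given `M`, the equation for `ν` is linear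
(`eqOn_of_hasDerivWithinAt`).

*Existence.* The derivative of `(k₁, k₂) ↦ k₁ k₂` at the identity of `G₊ × G₋` is the sum map
`𝔤₊ × 𝔤₋ → 𝔤`, an isomorphism, so the inverse function theorem factorizes `exp(-t D_{μ₀}H)` for
small `t` (`exists_isFactorization`).
-/

noncomputable section

/-! ### Linear differential equations on compact intervals -/

section LinearODE

open Metric

variable {F : Type*} [NormedAddCommGroup F] [NormedSpace ℝ F]

/-- Two-sided Grönwall estimate on a compact interval. -/
theorem norm_le_exp_of_norm_deriv_le {f f' : ℝ → F} {K α β t₀ : ℝ} (ht₀ : t₀ ∈ Icc α β)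
    (hf : ∀ t ∈ Icc α β, HasDerivWithinAt f (f' t) (Icc α β) t)
    (bound : ∀ t ∈ Icc α β, ‖f' t‖ ≤ K * ‖f t‖) {t : ℝ} (ht : t ∈ Icc α β) :
    ‖f t‖ ≤ ‖f t₀‖ * Real.exp (K * |t - t₀|) := by
  rcases le_total t₀ t with h | h
  · have := norm_le_gronwallBound_of_norm_deriv_right_le (f := f) (f' := f') (δ := ‖f t₀‖) (K := K)
      (ε := 0) (a := t₀) (b := t)
      (fun s hs => ((hf s ⟨ht₀.1.trans hs.1, hs.2.trans ht.2⟩).continuousWithinAt).mono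
        (Icc_subset_Icc ht₀.1 ht.2))
      (fun s hs => ((hf s ⟨ht₀.1.trans hs.1, hs.2.le.trans ht.2⟩).mono
        (Icc_subset_Icc_left (ht₀.1.trans hs.1))).mono_of_mem_nhdsWithin
        (Icc_mem_nhdsGE (hs.2.trans_le ht.2))) le_rfl
      (fun s hs => by simpa using bound s ⟨ht₀.1.trans hs.1, hs.2.le.trans ht.2⟩) t ⟨h, le_rfl⟩
    rwa [gronwallBound_ε0, ← abs_of_nonneg (sub_nonneg.2 h)] at this
  · have hmaps : MapsTo (fun s : ℝ => -s) (Icc (-t₀) (-t)) (Icc α β) := fun s hs =>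
      ⟨by linarith [ht.1, hs.2], by linarith [ht₀.2, hs.1]⟩
    have hd : ∀ s ∈ Icc (-t₀) (-t),
        HasDerivWithinAt (fun s => f (-s)) (-(f' (-s))) (Icc (-t₀) (-t)) s := fun s hs => by
      simpa [Function.comp_def] using
        (hf (-s) (hmaps hs)).scomp s (hasDerivAt_neg s).hasDerivWithinAt hmaps
    have := norm_le_gronwallBound_of_norm_deriv_right_le (f := fun s => f (-s))
      (f' := fun s => -(f' (-s))) (δ := ‖f t₀‖) (K := K)
      (ε := 0) (a := -t₀) (b := -t)
      (fun s hs => (hd s hs).continuousWithinAt)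
      (fun s hs => ((hd s ⟨hs.1, hs.2.le⟩).mono
        (Icc_subset_Icc_left hs.1)).mono_of_mem_nhdsWithin (Icc_mem_nhdsGE hs.2)) (by simp)
      (fun s hs => by simpa using bound (-s) (hmaps ⟨hs.1, hs.2.le⟩)) (-t) ⟨by linarith, le_rfl⟩
    rw [gronwallBound_ε0] at this
    rw [abs_sub_comm, abs_of_nonneg (sub_nonneg.2 h)]
    simpa [neg_add_eq_sub] using this

/-- The radial retraction of a normed space onto the closed ball of radius `r`. -/
def radialRetraction (r : ℝ) (x : F) : F := (r / max r ‖x‖) • x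

theorem norm_radialRetraction_le_norm {r : ℝ} (hr : 0 < r) (x : F) :
    ‖radialRetraction r x‖ ≤ ‖x‖ := by
  rw [radialRetraction, norm_smul, Real.norm_of_nonneg (by positivity)]
  exact mul_le_of_le_one_left (norm_nonneg _)
    ((div_le_one (by positivity)).2 (le_max_left _ _))

theorem norm_radialRetraction_le {r : ℝ} (hr : 0 < r) (x : F) :
    ‖radialRetraction r x‖ ≤ r := by
  rw [radialRetraction, norm_smul, Real.norm_of_nonneg (by positivity), div_mul_eq_mul_div,
    div_le_iff₀ (by positivity)]
  exact mul_le_mul_of_nonneg_left (le_max_right _ _) hr.le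

theorem radialRetraction_eq_self {r : ℝ} (hr : 0 < r) {x : F} (hx : ‖x‖ ≤ r) :
    radialRetraction r x = x := by
  rw [radialRetraction, max_eq_left hx, div_self hr.ne', one_smul]

theorem norm_radialRetraction_sub_le {r : ℝ} (hr : 0 < r) (x y : F) :
    ‖radialRetraction r x - radialRetraction r y‖ ≤ 2 * ‖x - y‖ := by
  have hm : 0 < max r ‖x‖ := lt_max_of_lt_left hr
  have hn : 0 < max r ‖y‖ := lt_max_of_lt_left hr
  have e : radialRetraction r x - radialRetraction r y =
      (r / max r ‖x‖) • (x - y) + (r / max r ‖x‖ - r / max r ‖y‖) • y := by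
    simp only [radialRetraction]; module
  have h1 : ‖(r / max r ‖x‖) • (x - y)‖ ≤ ‖x - y‖ := by
    rw [norm_smul, Real.norm_of_nonneg (by positivity)]
    exact mul_le_of_le_one_left (norm_nonneg _) ((div_le_one hm).2 (le_max_left _ _))
  have h2 : ‖(r / max r ‖x‖ - r / max r ‖y‖) • y‖ ≤ ‖x - y‖ := by
    have e2 : r / max r ‖x‖ - r / max r ‖y‖ =
        r / max r ‖x‖ * ((max r ‖y‖ - max r ‖x‖) / max r ‖y‖) := by
      field_simp
    rw [norm_smul, e2, norm_mul, norm_div _ (max r ‖y‖),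
      Real.norm_of_nonneg (div_nonneg hr.le hm.le), Real.norm_of_nonneg hn.le, mul_assoc,
      div_mul_eq_mul_div _ (max r ‖y‖)]
    have h3 : ‖max r ‖y‖ - max r ‖x‖‖ ≤ ‖x - y‖ := by
      rw [Real.norm_eq_abs]
      rw [max_comm r, max_comm r]
      refine (abs_max_sub_max_le_abs _ _ _).trans ?_
      rw [abs_sub_comm]
      exact abs_norm_sub_norm_le _ _
    have h4 : ‖max r ‖y‖ - max r ‖x‖‖ * ‖y‖ / max r ‖y‖ ≤ ‖x - y‖ := by
      rw [div_le_iff₀ hn]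
      exact mul_le_mul h3 (le_max_right _ _) (norm_nonneg _) (norm_nonneg _)
    exact (mul_le_of_le_one_left (by positivity)
      ((div_le_one hm).2 (le_max_left _ _))).trans h4
  rw [e]
  linarith [norm_add_le ((r / max r ‖x‖) • (x - y)) ((r / max r ‖x‖ - r / max r ‖y‖) • y)]

/-- Solutions of a linear differential equation on a compact interval are determined by their
value at one point. -/
theorem linearODE_unique {A : ℝ → F →L[ℝ] F} {α β t₀ : ℝ} (hA : ContinuousOn A (Icc α β))
    (ht₀ : t₀ ∈ Icc α β) {u v : ℝ → F}
    (hu : ∀ t ∈ Icc α β, HasDerivWithinAt u (A t (u t)) (Icc α β) t)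
    (hv : ∀ t ∈ Icc α β, HasDerivWithinAt v (A t (v t)) (Icc α β) t) (h : u t₀ = v t₀) :
    EqOn u v (Icc α β) := by
  obtain ⟨K, hK⟩ := isCompact_Icc.exists_bound_of_continuousOn hA
  intro t ht
  have := norm_le_exp_of_norm_deriv_le (f := fun t => u t - v t) (K := K) ht₀
    (fun t ht => (hu t ht).sub (hv t ht)) (fun t ht => by
      rw [← map_sub]
      exact (A t).le_of_opNorm_le (hK t ht) _) ht
  rw [h, sub_self, norm_zero, zero_mul] at this
  exact sub_eq_zero.1 (norm_le_zero_iff.1 this)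

/-- A linear differential equation with continuous coefficients on a compact interval has a
solution on the whole interval. The right-hand side is composed with a radial retraction, which
makes it bounded, so that the Picard--Lindelöf theorem applies on the whole interval; by Grönwall's
inequality the solution stays where the retraction is the identity. -/
theorem linearODE_exists [CompleteSpace F] {A : ℝ → F →L[ℝ] F} {α β t₀ : ℝ}
    (hA : ContinuousOn A (Icc α β)) (ht₀ : t₀ ∈ Icc α β) (x : F) :
    ∃ u : ℝ → F, u t₀ = x ∧ ∀ t ∈ Icc α β, HasDerivWithinAt u (A t (u t)) (Icc α β) t := by
  obtain ⟨K', hK'⟩ := isCompact_Icc.exists_bound_of_continuousOn hA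
  set K : ℝ := max K' 0
  have hK0 : 0 ≤ K := le_max_right _ _
  have hK : ∀ t ∈ Icc α β, ‖A t‖ ≤ K := fun t ht => (hK' t ht).trans (le_max_left _ _)
  set T : ℝ := β - α
  have hT : 0 ≤ T := sub_nonneg.2 (ht₀.1.trans ht₀.2)
  set r : ℝ := ‖x‖ * Real.exp (K * T) + 1
  have hr : 0 < r := by positivity
  have hP : IsPicardLindelof (fun t y => A t (radialRetraction r y)) (⟨t₀, ht₀⟩ : Icc α β) x
      (NNReal.mk (K * r * T) (by positivity)) 0 (NNReal.mk (K * r) (by positivity))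
      (NNReal.mk (K * 2) (by positivity)) := by
    refine ⟨fun t ht => ?_, fun y _ => ?_, fun t ht y _ => ?_, ?_⟩
    · refine LipschitzOnWith.of_dist_le_mul fun y _ z _ => ?_
      rw [dist_eq_norm, dist_eq_norm, ← map_sub, NNReal.coe_mk, mul_assoc]
      exact ((A t).le_of_opNorm_le (hK t ht) _).trans
        (mul_le_mul_of_nonneg_left (norm_radialRetraction_sub_le hr y z) hK0)
    · exact hA.clm_apply continuousOn_const
    · exact ((A t).le_of_opNorm_le (hK t ht) _).trans
        (mul_le_mul_of_nonneg_left (norm_radialRetraction_le hr y) hK0)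
    · simp only [NNReal.coe_mk, NNReal.coe_zero, sub_zero]
      refine mul_le_mul_of_nonneg_left (max_le ?_ ?_) (by positivity)
      · exact sub_le_sub_left ht₀.1 _
      · exact sub_le_sub_right ht₀.2 _
  obtain ⟨u, hu0, hu⟩ := hP.exists_eq_forall_mem_Icc_hasDerivWithinAt₀
  refine ⟨u, hu0, fun t ht => ?_⟩
  have hb := norm_le_exp_of_norm_deriv_le (K := K) ht₀ hu (fun s hs =>
    ((A s).le_of_opNorm_le (hK s hs) _).trans
      (mul_le_mul_of_nonneg_left (norm_radialRetraction_le_norm hr _) hK0)) ht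
  have hur : ‖u t‖ ≤ r := by
    refine hb.trans ?_
    have hx : u t₀ = x := hu0
    rw [hx]
    have : |t - t₀| ≤ T := by
      rw [abs_le]; constructor <;> simp only [T] <;> linarith [ht.1, ht.2, ht₀.1, ht₀.2]
    have : ‖x‖ * Real.exp (K * |t - t₀|) ≤ ‖x‖ * Real.exp (K * T) := by gcongr
    simp only [r]; linarith
  have := hu t ht
  rwa [radialRetraction_eq_self hr hur] at this

/-- The propagator of a linear differential equation with continuous coefficients: a family of
bounded bijections `U t` with `U' = A U` and `U t₀ = 1`. -/
theorem exists_propagator [CompleteSpace F] {A : ℝ → F →L[ℝ] F} {α β t₀ : ℝ}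
    (hA : ContinuousOn A (Icc α β)) (ht₀ : t₀ ∈ Icc α β) :
    ∃ U : ℝ → F →L[ℝ] F, U t₀ = ContinuousLinearMap.id ℝ F ∧
      (∀ t ∈ Icc α β, ∀ x, HasDerivWithinAt (fun s => U s x) (A t (U t x)) (Icc α β) t) ∧
      ∀ t ∈ Icc α β, Function.Surjective (U t) := by
  have hA' : ContinuousOn (fun t => ContinuousLinearMap.compL ℝ F F F (A t)) (Icc α β) :=
    (ContinuousLinearMap.compL ℝ F F F).continuous.comp_continuousOn hA
  obtain ⟨U, hU0, hU⟩ := linearODE_exists hA' ht₀ (ContinuousLinearMap.id ℝ F)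
  have hU' : ∀ t ∈ Icc α β, ∀ x, HasDerivWithinAt (fun s => U s x) (A t (U t x)) (Icc α β) t :=
    fun t ht x => by
      simpa using (hU t ht).clm_apply (hasDerivWithinAt_const t (Icc α β) x)
  refine ⟨U, hU0, hU', fun t ht z => ?_⟩
  -- solve the equation backwards from the value `z` at time `t`
  obtain ⟨u, hu0, hu⟩ := linearODE_exists hA ht z
  refine ⟨u t₀, ?_⟩
  rw [← hu0]
  exact linearODE_unique hA ht₀ (fun s hs => hU' s hs (u t₀)) hu (by simp [hU0]) ht

end LinearODE

/-! ### A Banach Lie group in the chart at the identity -/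

section ChartCalculus

open Filter Topology

variable {E : Type*} [NormedAddCommGroup E] [NormedSpace ℝ E]
  {G : Type*} [TopologicalSpace G] [ChartedSpace E G] [Group G]

variable (E G) in
/-- The preferred chart of a Banach Lie group at the identity. -/
abbrev oneChart : PartialEquiv G E := extChartAt 𝓘(ℝ, E) (1 : G)

/-- The group multiplication in the chart at the identity. -/
def chartMul (G : Type*) [TopologicalSpace G] [ChartedSpace E G] [Group G] (p : E × E) : E :=
  oneChart E G ((oneChart E G).symm p.1 * (oneChart E G).symm p.2)

/-- The adjoint action `Ad_g`, as an operator on the model space: the derivative at the identity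
of conjugation by `g`, read in the chart at the identity. -/
def chartAd (g : G) : E →L[ℝ] E :=
  fderiv ℝ (fun z => oneChart E G (g * (oneChart E G).symm z * g⁻¹)) (oneChart E G 1)

/-- The derivative of a map of manifolds, read in the preferred charts. The point `y` is
separate from `f x` so that the chart at the image can be taken at a syntactically simpler point. -/
theorem mfderiv_eq_fderiv_extChartAt {E' M M' : Type*} [NormedAddCommGroup E'] [NormedSpace ℝ E']
    [TopologicalSpace M] [ChartedSpace E M] [TopologicalSpace M'] [ChartedSpace E' M']
    {f : M → M'} {x : M} {y : M'} (hy : f x = y)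
    (hf : MDifferentiableAt 𝓘(ℝ, E) 𝓘(ℝ, E') f x) (v : E) :
    (mfderiv 𝓘(ℝ, E) 𝓘(ℝ, E') f x : E →L[ℝ] E') v =
      fderiv ℝ (fun z => extChartAt 𝓘(ℝ, E') y (f ((extChartAt 𝓘(ℝ, E) x).symm z)))
        (extChartAt 𝓘(ℝ, E) x x) v := by
  subst hy
  let D : E →L[ℝ] E' := mfderiv 𝓘(ℝ, E) 𝓘(ℝ, E') f x
  have h : HasFDerivWithinAt (writtenInExtChartAt 𝓘(ℝ, E) 𝓘(ℝ, E') x f) D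
      (range (𝓘(ℝ, E) : E → E)) (extChartAt 𝓘(ℝ, E) x x) := hf.hasMFDerivAt.2
  rw [ModelWithCorners.range_eq_univ, hasFDerivWithinAt_univ] at h
  change D v = _
  rw [← h.fderiv]
  rfl

theorem oneChart_source_mem_nhds_one : (oneChart E G).source ∈ 𝓝 (1 : G) :=
  extChartAt_source_mem_nhds (I := 𝓘(ℝ, E)) (1 : G)

theorem oneChart_symm_one : (oneChart E G).symm (oneChart E G 1) = 1 :=
  extChartAt_to_inv (I := 𝓘(ℝ, E)) (1 : G)

theorem one_mem_oneChart_source : (1 : G) ∈ (oneChart E G).source :=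
  mem_extChartAt_source (I := 𝓘(ℝ, E)) (1 : G)

theorem oneChart_target_mem_nhds {g : G} (hg : g ∈ (oneChart E G).source) :
    (oneChart E G).target ∈ 𝓝 (oneChart E G g) :=
  (isOpen_extChartAt_target (I := 𝓘(ℝ, E)) (1 : G)).mem_nhds ((oneChart E G).map_source hg)

theorem eventually_mem_oneChart_target : ∀ᶠ z in 𝓝 (oneChart E G 1), z ∈ (oneChart E G).target :=
  oneChart_target_mem_nhds one_mem_oneChart_source

theorem ContinuousAt.eventually_mem_oneChart_source {X : Type*} [TopologicalSpace X]
    {f : X → G} {x : X}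
    (hf : ContinuousAt f x) (hx : f x = 1) :
    ∀ᶠ y in 𝓝 x, f y ∈ (oneChart E G).source := by
  refine hf.eventually ?_
  rw [hx]
  exact oneChart_source_mem_nhds_one

theorem chartAd_one : chartAd (1 : G) = ContinuousLinearMap.id ℝ E := by
  refine HasFDerivAt.fderiv ((hasFDerivAt_id _).congr_of_eventuallyEq ?_)
  filter_upwards [eventually_mem_oneChart_target (E := E) (G := G)] with z hz
  rw [one_mul, inv_one, mul_one, (oneChart E G).right_inv hz, id]

variable [LieGroup 𝓘(ℝ, E) ∞ G]

theorem contMDiffAt_oneChart {g : G} (hg : g ∈ (oneChart E G).source) :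
    ContMDiffAt 𝓘(ℝ, E) 𝓘(ℝ, E) ∞ (oneChart E G) g :=
  contMDiffAt_extChartAt' (by simpa using hg)

theorem contMDiffAt_oneChart_symm {z : E} (hz : z ∈ (oneChart E G).target) :
    ContMDiffAt 𝓘(ℝ, E) 𝓘(ℝ, E) ∞ (oneChart E G).symm z :=
  (contMDiffOn_extChartAt_symm (1 : G)).contMDiffAt
    ((isOpen_extChartAt_target (I := 𝓘(ℝ, E)) (1 : G)).mem_nhds hz)

theorem ContMDiffAt.contDiffAt_oneChart {F : Type*} [NormedAddCommGroup F] [NormedSpace ℝ F]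
    {f : F → G} {x : F} (hf : ContMDiffAt 𝓘(ℝ, F) 𝓘(ℝ, E) ∞ f x)
    (hx : f x ∈ (oneChart E G).source) : ContDiffAt ℝ ∞ (fun y => oneChart E G (f y)) x :=
  ((contMDiffAt_oneChart hx).comp x hf).contDiffAt

theorem ContDiffAt.contMDiffAt_oneChart_symm {F : Type*} [NormedAddCommGroup F] [NormedSpace ℝ F]
    {f : F → E} {x : F} (hf : ContDiffAt ℝ ∞ f x)
    (hx : f x ∈ (oneChart E G).target) :
    ContMDiffAt 𝓘(ℝ, F) 𝓘(ℝ, E) ∞ (fun y => (oneChart E G).symm (f y)) x :=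
  (_root_.contMDiffAt_oneChart_symm hx).comp x hf.contMDiffAt

theorem contDiffAt_chartMul {g h : G} (hg : g ∈ (oneChart E G).source)
    (hh : h ∈ (oneChart E G).source) (hgh : g * h ∈ (oneChart E G).source) :
    ContDiffAt ℝ ∞ (chartMul (E := E) G) (oneChart E G g, oneChart E G h) := by
  refine ContMDiffAt.contDiffAt_oneChart (ContMDiffAt.mul
    (contDiffAt_fst.contMDiffAt_oneChart_symm ((oneChart E G).map_source hg))
    (contDiffAt_snd.contMDiffAt_oneChart_symm ((oneChart E G).map_source hh))) ?_
  simpa only [(oneChart E G).left_inv hg, (oneChart E G).left_inv hh] using hgh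

/-- Conjugation is jointly smooth in the chart at the identity. Its partial derivative in the second
variable is the adjoint action, which is therefore smooth near the identity. -/
theorem contDiffAt_chartConj :
    ContDiffAt ℝ ∞ (fun p : E × E => oneChart E G ((oneChart E G).symm p.1 *
      (oneChart E G).symm p.2 * ((oneChart E G).symm p.1)⁻¹)) (oneChart E G 1, oneChart E G 1) := by
  have h1 : oneChart E G 1 ∈ (oneChart E G).target :=
    (oneChart E G).map_source one_mem_oneChart_source
  refine ContMDiffAt.contDiffAt_oneChart (ContMDiffAt.mul (ContMDiffAt.mul
    (contDiffAt_fst.contMDiffAt_oneChart_symm h1)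
    (contDiffAt_snd.contMDiffAt_oneChart_symm h1))
    (ContMDiffAt.inv (contDiffAt_fst.contMDiffAt_oneChart_symm h1))) ?_
  simp only [oneChart_symm_one, mul_one, inv_one]
  exact one_mem_oneChart_source

theorem contDiffAt_conj_const (g : G) :
    ContDiffAt ℝ ∞ (fun z => oneChart E G (g * (oneChart E G).symm z * g⁻¹)) (oneChart E G 1) := by
  have h1 : oneChart E G 1 ∈ (oneChart E G).target :=
    (oneChart E G).map_source one_mem_oneChart_source
  refine ContMDiffAt.contDiffAt_oneChart (ContMDiffAt.mul (ContMDiffAt.mul contMDiffAt_const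
    (contDiffAt_id.contMDiffAt_oneChart_symm h1)) contMDiffAt_const) ?_
  simp only [oneChart_symm_one, mul_one, mul_inv_cancel]
  exact one_mem_oneChart_source

theorem hasFDerivAt_conj_const (g : G) :
    HasFDerivAt (fun z => oneChart E G (g * (oneChart E G).symm z * g⁻¹)) (chartAd g : E →L[ℝ] E)
      (oneChart E G 1) :=
  ((contDiffAt_conj_const g).differentiableAt (by simp)).hasFDerivAt

theorem contMDiff_conj (g : G) :
    ContMDiff 𝓘(ℝ, E) 𝓘(ℝ, E) ∞ (fun x : G => g * x * g⁻¹) :=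
  (contMDiff_const.mul contMDiff_id).mul contMDiff_const

theorem adjointAction_apply_eq_chartAd (g : G) (v : E) :
    (adjointAction g : E →L[ℝ] E) v = chartAd g v :=
  mfderiv_eq_fderiv_extChartAt (y := (1 : G)) (by simp)
    ((contMDiff_conj g).mdifferentiable (by simp) 1) v

theorem chartAd_mul (g h : G) :
    (chartAd (g * h) : E →L[ℝ] E) = (chartAd g).comp (chartAd h) := by
  have h1 : oneChart E G 1 ∈ (oneChart E G).target :=
    (oneChart E G).map_source one_mem_oneChart_source
  have hh := hasFDerivAt_conj_const (E := E) h
  have hg : HasFDerivAt (fun z => oneChart E G (g * (oneChart E G).symm z * g⁻¹))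
      (chartAd g : E →L[ℝ] E) (oneChart E G (h * (oneChart E G).symm (oneChart E G 1) * h⁻¹)) := by
    simpa only [oneChart_symm_one, mul_one, mul_inv_cancel] using hasFDerivAt_conj_const g
  refine HasFDerivAt.fderiv ((HasFDerivAt.comp (f := fun z => oneChart E G
    (h * (oneChart E G).symm z * h⁻¹)) _ hg hh).congr_of_eventuallyEq ?_)
  have hc : ContinuousAt (fun z => h * (oneChart E G).symm z * h⁻¹) (oneChart E G 1) :=
    ((ContMDiffAt.mul (ContMDiffAt.mul contMDiffAt_const
      (contDiffAt_id.contMDiffAt_oneChart_symm h1)) contMDiffAt_const :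
      ContMDiffAt 𝓘(ℝ, E) 𝓘(ℝ, E) ∞ _ _)).continuousAt
  filter_upwards [hc.eventually_mem_oneChart_source (E := E) (by simp)] with z hz
  rw [Function.comp_apply, (oneChart E G).left_inv hz]
  simp only [mul_inv_rev, mul_assoc]

theorem contDiffAt_chartMul_one :
    ContDiffAt ℝ ∞ (chartMul (E := E) G) (oneChart E G 1, oneChart E G 1) :=
  contDiffAt_chartMul one_mem_oneChart_source one_mem_oneChart_source
    (by rw [mul_one]; exact one_mem_oneChart_source)

/-- The derivative of the multiplication at `(g, 1)` along the second factor. -/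
theorem hasFDerivAt_mul_left {g : G} (hg : g ∈ (oneChart E G).source) :
    HasFDerivAt (fun z => oneChart E G (g * (oneChart E G).symm z))
      ((fderiv ℝ (chartMul (E := E) G) (oneChart E G g, oneChart E G 1)).comp
        (ContinuousLinearMap.inr ℝ E E)) (oneChart E G 1) := by
  have hd := ((contDiffAt_chartMul hg one_mem_oneChart_source (by rwa [mul_one])).differentiableAt
    (by simp)).hasFDerivAt
  have := hd.comp (oneChart E G 1) (hasFDerivAt_prodMk_right (oneChart E G g) (oneChart E G 1))
  simpa only [Function.comp_def, chartMul, (oneChart E G).left_inv hg] using this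

/-- The derivative of the multiplication at `(1, g)` along the first factor. -/
theorem hasFDerivAt_mul_right {g : G} (hg : g ∈ (oneChart E G).source) :
    HasFDerivAt (fun z => oneChart E G ((oneChart E G).symm z * g))
      ((fderiv ℝ (chartMul (E := E) G) (oneChart E G 1, oneChart E G g)).comp
        (ContinuousLinearMap.inl ℝ E E)) (oneChart E G 1) := by
  have hd := ((contDiffAt_chartMul one_mem_oneChart_source hg (by rwa [one_mul])).differentiableAt
    (by simp)).hasFDerivAt
  have := HasFDerivAt.comp (f := fun z => (z, oneChart E G g)) (oneChart E G 1) hd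
    (hasFDerivAt_prodMk_left (oneChart E G 1) (oneChart E G g))
  simpa only [Function.comp_def, chartMul, (oneChart E G).left_inv hg] using this

theorem fderiv_chartMul_one_inr (v : E) :
    fderiv ℝ (chartMul (E := E) G) (oneChart E G 1, oneChart E G 1) (0, v) = v := by
  have h : HasFDerivAt (fun z => oneChart E G (1 * (oneChart E G).symm z))
      (ContinuousLinearMap.id ℝ E) (oneChart E G 1) := by
    refine (hasFDerivAt_id _).congr_of_eventuallyEq ?_
    filter_upwards [eventually_mem_oneChart_target (E := E) (G := G)] with z hz
    rw [one_mul, (oneChart E G).right_inv hz, id]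
  exact congr($((hasFDerivAt_mul_left one_mem_oneChart_source).unique h) v)

theorem fderiv_chartMul_one_inl (v : E) :
    fderiv ℝ (chartMul (E := E) G) (oneChart E G 1, oneChart E G 1) (v, 0) = v := by
  have h : HasFDerivAt (fun z => oneChart E G ((oneChart E G).symm z * 1))
      (ContinuousLinearMap.id ℝ E) (oneChart E G 1) := by
    refine (hasFDerivAt_id _).congr_of_eventuallyEq ?_
    filter_upwards [eventually_mem_oneChart_target (E := E) (G := G)] with z hz
    rw [mul_one, (oneChart E G).right_inv hz, id]
  exact congr($((hasFDerivAt_mul_right one_mem_oneChart_source).unique h) v)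

/-- `Ad_g` intertwines the right translation by `g` with the left translation by `g`. -/
theorem fderiv_chartMul_chartAd {g : G} (hg : g ∈ (oneChart E G).source) (v : E) :
    fderiv ℝ (chartMul (E := E) G) (oneChart E G 1, oneChart E G g) (chartAd g v, 0) =
      fderiv ℝ (chartMul (E := E) G) (oneChart E G g, oneChart E G 1) (0, v) := by
  have h1 : oneChart E G 1 ∈ (oneChart E G).target :=
    (oneChart E G).map_source one_mem_oneChart_source
  have hr := hasFDerivAt_mul_right (E := E) hg
  have e : oneChart E G (1 : G) =
      oneChart E G (g * (oneChart E G).symm (oneChart E G 1) * g⁻¹) := by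
    simp only [oneChart_symm_one, mul_one, mul_inv_cancel]
  rw [e] at hr
  have hcomp := hr.comp (oneChart E G 1) (hasFDerivAt_conj_const g)
  rw [← e] at hcomp
  have hc : ContinuousAt (fun z => g * (oneChart E G).symm z * g⁻¹) (oneChart E G 1) :=
    ((ContMDiffAt.mul (ContMDiffAt.mul contMDiffAt_const
      (contDiffAt_id.contMDiffAt_oneChart_symm h1)) contMDiffAt_const :
      ContMDiffAt 𝓘(ℝ, E) 𝓘(ℝ, E) ∞ _ _)).continuousAt
  have hl := (hasFDerivAt_mul_left (E := E) hg).congr_of_eventuallyEq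
    (f₁ := (fun z => oneChart E G ((oneChart E G).symm z * g)) ∘
      fun z => oneChart E G (g * (oneChart E G).symm z * g⁻¹)) (by
    filter_upwards [hc.eventually_mem_oneChart_source (E := E) (by simp)] with z hz
    simp only [Function.comp_apply, (oneChart E G).left_inv hz, inv_mul_cancel_right])
  exact congr($(hcomp.unique hl) v)

end ChartCalculus

/-! ### The derivative of the adjoint action -/

section AdjointDerivative

open Filter Topology

variable {E : Type*} [NormedAddCommGroup E] [NormedSpace ℝ E]
  {G : Type*} [TopologicalSpace G] [ChartedSpace E G] [Group G]

/-- The bracket of the Lie algebra, read in the chart at the identity: the antisymmetrization of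
the mixed second derivative of the multiplication. -/
def chartBracket (G : Type*) [TopologicalSpace G] [ChartedSpace E G] [Group G] (v w : E) : E :=
  fderiv ℝ (fderiv ℝ (chartMul (E := E) G)) (oneChart E G 1, oneChart E G 1) (v, 0) (0, w)
    - fderiv ℝ (fderiv ℝ (chartMul (E := E) G)) (oneChart E G 1, oneChart E G 1) (w, 0) (0, v)

/-- The left-invariant vector field with value `v` at the identity, read in the chart at the
identity. -/
def chartLeftField (G : Type*) [TopologicalSpace G] [ChartedSpace E G] [Group G] (v z : E) : E :=
  fderiv ℝ (chartMul (E := E) G) (z, oneChart E G 1) (0, v)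

/-- The curve `γ` in a Banach Lie group has right velocity `a` at time `t`: `γ'(t) = a γ(t)`, that
is, the curve `s ↦ γ(s) γ(t)⁻¹` through the identity has velocity `a` at `s = t`. The velocity is
read in the chart at the identity; continuity of `γ` ensures that the curve stays in its domain. -/
structure HasRightVelocity (γ : ℝ → G) (a : E) (t : ℝ) : Prop where
  continuousAt : ContinuousAt γ t
  hasDerivAt : HasDerivAt (fun s => oneChart E G (γ s * (γ t)⁻¹)) a t

theorem HasRightVelocity.unique {γ : ℝ → G} {a b : E} {t : ℝ}
    (ha : HasRightVelocity γ a t) (hb : HasRightVelocity γ b t) : a = b :=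
  ha.hasDerivAt.unique hb.hasDerivAt

theorem HasRightVelocity.congr_of_eventuallyEq {γ δ : ℝ → G} {a : E} {t : ℝ}
    (h : HasRightVelocity γ a t) (hδ : δ =ᶠ[𝓝 t] γ) : HasRightVelocity δ a t := by
  refine ⟨h.continuousAt.congr hδ.symm, h.hasDerivAt.congr_of_eventuallyEq ?_⟩
  filter_upwards [hδ] with s hs
  rw [hs, hδ.self_of_nhds]

variable [LieGroup 𝓘(ℝ, E) ∞ G]

theorem contDiffAt_fderiv_chartMul {g : G} (hg : g ∈ (oneChart E G).source) :
    ContDiffAt ℝ ∞ (fderiv ℝ (chartMul (E := E) G)) (oneChart E G g, oneChart E G 1) :=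
  (contDiffAt_chartMul hg one_mem_oneChart_source (by rwa [mul_one])).fderiv_right (by simp)

theorem contDiffOn_chartLeftField (v : E) :
    ContDiffOn ℝ ∞ (chartLeftField G v) (oneChart E G).target := by
  intro z hz
  have h := contDiffAt_fderiv_chartMul (E := E) ((oneChart E G).map_target hz)
  rw [(oneChart E G).right_inv hz] at h
  exact ((ContDiffAt.comp (f := fun z => (z, oneChart E G 1)) z h
    (contDiffAt_id.prodMk contDiffAt_const)).clm_apply contDiffAt_const).contDiffWithinAt

theorem hasFDerivAt_fderiv_chartMul :
    HasFDerivAt (fderiv ℝ (chartMul (E := E) G))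
      (fderiv ℝ (fderiv ℝ (chartMul (E := E) G)) (oneChart E G 1, oneChart E G 1))
      (oneChart E G 1, oneChart E G 1) :=
  ((contDiffAt_fderiv_chartMul (E := E) one_mem_oneChart_source).differentiableAt
    (by simp)).hasFDerivAt

/-- Symmetry of the second derivative of the multiplication at the identity. -/
theorem fderiv_fderiv_chartMul_symm (p q : E × E) :
    fderiv ℝ (fderiv ℝ (chartMul (E := E) G)) (oneChart E G 1, oneChart E G 1) p q =
      fderiv ℝ (fderiv ℝ (chartMul (E := E) G)) (oneChart E G 1, oneChart E G 1) q p :=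
  (contDiffAt_chartMul_one.isSymmSndFDerivAt (by
    rw [minSmoothness_of_isRCLikeNormedField]; exact WithTop.coe_le_coe.2 le_top)).eq p q

theorem hasFDerivAt_chartLeftField (v : E) :
    HasFDerivAt (chartLeftField G v)
      (((fderiv ℝ (fderiv ℝ (chartMul (E := E) G)) (oneChart E G 1, oneChart E G 1)).comp
        (ContinuousLinearMap.inl ℝ E E)).flip (0, v)) (oneChart E G 1) := by
  have h := HasFDerivAt.comp (f := fun z => (z, oneChart E G 1)) (oneChart E G 1)
    (hasFDerivAt_fderiv_chartMul (E := E) (G := G)) (hasFDerivAt_prodMk_left _ _)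
  have := h.clm_apply (hasFDerivAt_const ((0, v) : E × E) (oneChart E G 1))
  rwa [ContinuousLinearMap.comp_zero, zero_add] at this

/-- The map `g ↦ Ad_g y` is differentiable at the identity, with derivative `x ↦ [x, y]`. It is
smooth because conjugation is jointly smooth; its derivative is found by differentiating the
relation between left and right translations. -/
theorem hasFDerivAt_chartAd_symm (y : E) :
    ∃ D : E →L[ℝ] E, (∀ x, D x = chartBracket G x y) ∧
      HasFDerivAt (fun z => (chartAd ((oneChart E G).symm z) : E →L[ℝ] E) y) D
        (oneChart E G 1) := by
  set e : E := oneChart E G 1 with he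
  have hK := contDiffAt_chartConj (E := E) (G := G)
  have hdiff : DifferentiableAt ℝ (fun z => (chartAd ((oneChart E G).symm z) : E →L[ℝ] E) y) e := by
    have hs : ContDiffAt ℝ ∞ (fun z : E => fderiv ℝ (fun p : E × E => oneChart E G
        ((oneChart E G).symm p.1 * (oneChart E G).symm p.2 * ((oneChart E G).symm p.1)⁻¹))
        (z, e) (0, y)) e :=
      (ContDiffAt.comp (f := fun z => (z, e)) e
        (hK.fderiv_right (by simp)) (contDiffAt_id.prodMk contDiffAt_const)).clm_apply
        contDiffAt_const
    refine (hs.differentiableAt (by simp)).congr_of_eventuallyEq ?_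
    have hev : ∀ᶠ p in 𝓝 (e, e), ContDiffAt ℝ 1 (fun p : E × E => oneChart E G
        ((oneChart E G).symm p.1 * (oneChart E G).symm p.2 * ((oneChart E G).symm p.1)⁻¹)) p :=
      (hK.of_le (m := 1) (by exact_mod_cast le_top)).eventually (by simp)
    have hcont : ContinuousAt (fun z : E => (z, e)) e := by fun_prop
    filter_upwards [hcont.eventually hev] with z hz
    have := HasFDerivAt.comp (f := fun w => (z, w)) e (hz.differentiableAt (by simp)).hasFDerivAt
      (hasFDerivAt_prodMk_right z e)
    exact congr($(this.fderiv) y)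
  refine ⟨_, fun x => ?_, hdiff.hasFDerivAt⟩
  -- differentiate `z ↦ ∂₁m(e, z) (Ad_z y) = ∂₂m(z, e) y`, where `m` is the multiplication
  set D := fderiv ℝ (fun z => (chartAd ((oneChart E G).symm z) : E →L[ℝ] E) y) e
  have hw : HasFDerivAt (fun z => ((chartAd ((oneChart E G).symm z) : E →L[ℝ] E) y, (0 : E)))
      ((ContinuousLinearMap.inl ℝ E E).comp D) e :=
    (ContinuousLinearMap.inl ℝ E E).hasFDerivAt.comp e hdiff.hasFDerivAt
  have hA := HasFDerivAt.comp (f := fun z => (e, z)) e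
    (hasFDerivAt_fderiv_chartMul (E := E) (G := G)) (hasFDerivAt_prodMk_right _ _)
  have hL := hA.clm_apply hw
  have hev : (fun z => fderiv ℝ (chartMul (E := E) G) (e, z)
      ((chartAd ((oneChart E G).symm z) : E →L[ℝ] E) y, 0)) =ᶠ[𝓝 e] chartLeftField G y := by
    filter_upwards [eventually_mem_oneChart_target (E := E) (G := G)] with z hz
    have := fderiv_chartMul_chartAd ((oneChart E G).map_target hz) y
    rwa [(oneChart E G).right_inv hz] at this
  have hu := hL.unique ((hasFDerivAt_chartLeftField y).congr_of_eventuallyEq hev)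
  have hx := congr($hu x)
  simp only [he, oneChart_symm_one, chartAd_one, add_apply,
    ContinuousLinearMap.comp_apply, ContinuousLinearMap.flip_apply, ContinuousLinearMap.inl_apply,
    ContinuousLinearMap.inr_apply, ContinuousLinearMap.id_apply, fderiv_chartMul_one_inl,
    Function.comp_apply] at hx
  rw [chartBracket, ← hx, fderiv_fderiv_chartMul_symm (0, x) (y, 0)]
  abel

theorem mfderiv_oneChart_mulInvariantVectorField (v : E) {g : G}
    (hg : g ∈ (oneChart E G).source) :
    (mfderiv 𝓘(ℝ, E) 𝓘(ℝ, E) (oneChart E G) g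
      (mulInvariantVectorField (I := 𝓘(ℝ, E)) v g) : E) =
      chartLeftField G v (oneChart E G g) := by
  have hL : MDifferentiableAt 𝓘(ℝ, E) 𝓘(ℝ, E) (g * ·) (1 : G) :=
    (contMDiff_mul_left (I := 𝓘(ℝ, E)) (n := ∞)).mdifferentiable (by simp) 1
  have hC : MDifferentiableAt 𝓘(ℝ, E) 𝓘(ℝ, E) (oneChart E G) (g * 1) := by
    rw [mul_one]; exact (contMDiffAt_oneChart hg).mdifferentiableAt (by simp)
  have hcomp := mfderiv_comp_apply (1 : G) hC hL v
  have e := mfderiv_eq_fderiv_extChartAt (f := oneChart E G ∘ (g * ·)) (x := (1 : G)) rfl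
    (hC.comp 1 hL) v
  have e2 := (hasFDerivAt_mul_left (E := E) hg).fderiv
  have e3 : chartLeftField G v (oneChart E G g) =
      fderiv ℝ (fun z => oneChart E G (g * (oneChart E G).symm z)) (oneChart E G 1) v := by
    rw [e2]; rfl
  rw [e3]
  refine Eq.trans ?_ e
  refine Eq.trans ?_ hcomp.symm
  let X : E := mfderiv 𝓘(ℝ, E) 𝓘(ℝ, E) (g * ·) (1 : G) v
  suffices h : ∀ h : G, h = g → (mfderiv 𝓘(ℝ, E) 𝓘(ℝ, E) (oneChart E G) g : E →L[ℝ] E) X =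
      (mfderiv 𝓘(ℝ, E) 𝓘(ℝ, E) (oneChart E G) h : E →L[ℝ] E) X from h (g * 1) (mul_one g)
  rintro _ rfl
  rfl

theorem mpullbackWithin_mulInvariantVectorField (v : E) {z : E}
    (hz : z ∈ (oneChart E G).target) :
    (VectorField.mpullbackWithin 𝓘(ℝ, E) 𝓘(ℝ, E) (oneChart E G).symm
      (mulInvariantVectorField (I := 𝓘(ℝ, E)) (G := G) v) (range (𝓘(ℝ, E) : E → E)) z : E) =
      chartLeftField G v z := by
  have h1 := mfderiv_oneChart_mulInvariantVectorField (E := E) v ((oneChart E G).map_target hz)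
  rw [(oneChart E G).right_inv hz] at h1
  rw [← h1, VectorField.mpullbackWithin_apply, ContinuousLinearMap.inverse_eq
    (mfderivWithin_extChartAt_symm_comp_mfderiv_extChartAt hz)
    (mfderiv_extChartAt_comp_mfderivWithin_extChartAt_symm hz)]

theorem lieBracket_chartLeftField (v w : E) :
    VectorField.lieBracket ℝ (chartLeftField G v) (chartLeftField G w) (oneChart E G 1) =
      chartBracket G v w := by
  rw [VectorField.lieBracket_eq]
  simp only [(hasFDerivAt_chartLeftField (G := G) v).fderiv,
    (hasFDerivAt_chartLeftField (G := G) w).fderiv]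
  simp only [chartLeftField, fderiv_chartMul_one_inr, ContinuousLinearMap.flip_apply,
    ContinuousLinearMap.comp_apply, ContinuousLinearMap.inl_apply, chartBracket]

/-- The Lie bracket of the Lie algebra of the group, defined by left-invariant vector fields, is the
bracket read off from the second derivative of the multiplication. -/
theorem bracket_eq_chartBracket (v w : GroupLieAlgebra 𝓘(ℝ, E) G) :
    ⁅v, w⁆ = chartBracket (E := E) G v w := by
  have ev (v : E) : VectorField.mpullbackWithin 𝓘(ℝ, E) 𝓘(ℝ, E) (oneChart E G).symm
      (mulInvariantVectorField (I := 𝓘(ℝ, E)) (G := G) v) (range (𝓘(ℝ, E) : E → E))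
      =ᶠ[𝓝 (oneChart E G 1)] chartLeftField G v := by
    filter_upwards [eventually_mem_oneChart_target (E := E) (G := G)] with z hz
    exact mpullbackWithin_mulInvariantVectorField v hz
  have key : VectorField.lieBracketWithin ℝ
      (VectorField.mpullbackWithin 𝓘(ℝ, E) 𝓘(ℝ, E) (oneChart E G).symm
        (mulInvariantVectorField (I := 𝓘(ℝ, E)) (G := G) v) (range (𝓘(ℝ, E) : E → E)))
      (VectorField.mpullbackWithin 𝓘(ℝ, E) 𝓘(ℝ, E) (oneChart E G).symm
        (mulInvariantVectorField (I := 𝓘(ℝ, E)) (G := G) w) (range (𝓘(ℝ, E) : E → E)))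
      ((oneChart E G).symm ⁻¹' univ ∩ range (𝓘(ℝ, E) : E → E)) (oneChart E G 1) =
      chartBracket (E := E) G v w := by
    refine ((ev v).lieBracketWithin_vectorField_eq_nhds (ev w)).trans ?_
    rw [preimage_univ, ModelWithCorners.range_eq_univ, univ_inter,
      VectorField.lieBracketWithin_univ]
    exact lieBracket_chartLeftField (E := E) v w
  refine Eq.trans ?_ key
  rw [GroupLieAlgebra.bracket_def, VectorField.mlieBracket, VectorField.mlieBracketWithin_apply,
    mfderiv_extChartAt_self]
  exact congr($(ContinuousLinearMap.inverse_id (R := ℝ) (M := E)) _)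

theorem HasRightVelocity.continuousAt_mul_inv {γ : ℝ → G} {a : E} {t : ℝ}
    (h : HasRightVelocity γ a t) : ContinuousAt (fun s => γ s * (γ t)⁻¹) t := by
  have : IsTopologicalGroup G := topologicalGroup_of_lieGroup 𝓘(ℝ, E) ∞
  exact h.continuousAt.mul continuousAt_const

/-- The adjoint action along a curve with right velocity `a` satisfies the linear differential
equation `w' = [a, w]`. -/
theorem HasRightVelocity.hasDerivAt_chartAd {γ : ℝ → G} {a : E} {t : ℝ}
    (h : HasRightVelocity γ a t) (y : E) :
    HasDerivAt (fun s => (chartAd (γ s) : E →L[ℝ] E) y)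
      (chartBracket G a (chartAd (γ t) y)) t := by
  obtain ⟨D, hD, hd⟩ := hasFDerivAt_chartAd_symm (G := G) ((chartAd (γ t) : E →L[ℝ] E) y)
  rw [← hD]
  have e : oneChart E G 1 = oneChart E G (γ t * (γ t)⁻¹) := by rw [mul_inv_cancel]
  rw [e] at hd
  refine (HasFDerivAt.comp_hasDerivAt (f := fun s => oneChart E G (γ s * (γ t)⁻¹)) t hd
    h.hasDerivAt).congr_of_eventuallyEq ?_
  filter_upwards [h.continuousAt_mul_inv.eventually_mem_oneChart_source (E := E) (mul_inv_cancel _)]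
    with s hs
  rw [Function.comp_apply, (oneChart E G).left_inv hs, ← ContinuousLinearMap.comp_apply,
    ← chartAd_mul, inv_mul_cancel_right]

/-- The product rule `(γ δ)' = (a + Ad_γ b) γ δ` for right velocities. -/
theorem HasRightVelocity.mul {γ δ : ℝ → G} {a b : E} {t : ℝ}
    (hγ : HasRightVelocity γ a t) (hδ : HasRightVelocity δ b t) :
    HasRightVelocity (fun s => γ s * δ s) (a + chartAd (γ t) b) t := by
  have : IsTopologicalGroup G := topologicalGroup_of_lieGroup 𝓘(ℝ, E) ∞
  refine ⟨hγ.continuousAt.mul hδ.continuousAt, ?_⟩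
  have e (g : G) : oneChart E G 1 = oneChart E G (g * g⁻¹) := by rw [mul_inv_cancel]
  have hc := hasFDerivAt_conj_const (E := E) (γ t)
  rw [e (δ t)] at hc
  have h2 := HasFDerivAt.comp_hasDerivAt (f := fun s => oneChart E G (δ s * (δ t)⁻¹)) t hc
    hδ.hasDerivAt
  have h3 := hγ.hasDerivAt.prodMk h2
  have hm : HasFDerivAt (chartMul (E := E) G)
      (fderiv ℝ (chartMul (E := E) G) (oneChart E G 1, oneChart E G 1))
      (oneChart E G (γ t * (γ t)⁻¹),
        oneChart E G (γ t * (oneChart E G).symm (oneChart E G (δ t * (δ t)⁻¹)) * (γ t)⁻¹)) := by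
    simp only [mul_inv_cancel, oneChart_symm_one, mul_one]
    exact (contDiffAt_chartMul_one.differentiableAt (by simp)).hasFDerivAt
  have h4 := HasFDerivAt.comp_hasDerivAt (f := fun s => (oneChart E G (γ s * (γ t)⁻¹),
    oneChart E G (γ t * (oneChart E G).symm (oneChart E G (δ s * (δ t)⁻¹)) * (γ t)⁻¹))) t hm h3
  have e1 : ((a, chartAd (γ t) b) : E × E) = (a, 0) + (0, chartAd (γ t) b) := by simp
  rw [e1, map_add, fderiv_chartMul_one_inl, fderiv_chartMul_one_inr] at h4
  refine h4.congr_of_eventuallyEq ?_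
  have hcj : ContinuousAt (fun s => γ t * (δ s * (δ t)⁻¹) * (γ t)⁻¹) t :=
    (continuousAt_const.mul hδ.continuousAt_mul_inv).mul continuousAt_const
  filter_upwards [hγ.continuousAt_mul_inv.eventually_mem_oneChart_source (E := E)
      (mul_inv_cancel _),
    hδ.continuousAt_mul_inv.eventually_mem_oneChart_source (E := E) (mul_inv_cancel _),
    hcj.eventually_mem_oneChart_source (E := E) (by simp)] with s h1 h2 h3
  simp only [Function.comp_apply, chartMul]
  rw [(oneChart E G).left_inv h1, (oneChart E G).left_inv h2, (oneChart E G).left_inv h3]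
  congr 1
  group

end AdjointDerivative

/-! ### Right velocities of curves and the exponential map -/

section Curves

open Filter Topology

variable {E : Type*} [NormedAddCommGroup E] [NormedSpace ℝ E]
  {G : Type*} [TopologicalSpace G] [ChartedSpace E G] [Group G]

theorem contMDiffAt_hom_oneChart_symm {E' K : Type*} [NormedAddCommGroup E'] [NormedSpace ℝ E']
    [TopologicalSpace K] [ChartedSpace E' K] [Group K] [LieGroup 𝓘(ℝ, E') ∞ K]
    {ι : K →* G} (hι : ContMDiff 𝓘(ℝ, E') 𝓘(ℝ, E) ∞ ι) {z : E'}
    (hz : z ∈ (oneChart E' K).target) :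
    ContMDiffAt 𝓘(ℝ, E') 𝓘(ℝ, E) ∞ (fun z => ι ((oneChart E' K).symm z)) z :=
  hι.contMDiffAt.comp z (contMDiffAt_oneChart_symm hz)

variable [LieGroup 𝓘(ℝ, E) ∞ G]

theorem hasFDerivAt_hom {E' K : Type*} [NormedAddCommGroup E'] [NormedSpace ℝ E']
    [TopologicalSpace K] [ChartedSpace E' K] [Group K] [LieGroup 𝓘(ℝ, E') ∞ K]
    {ι : K →* G} (hι : ContMDiff 𝓘(ℝ, E') 𝓘(ℝ, E) ∞ ι) {D : E' →L[ℝ] E}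
    (hD : D = mfderiv 𝓘(ℝ, E') 𝓘(ℝ, E) ι 1) :
    HasFDerivAt (fun z => oneChart E G (ι ((oneChart E' K).symm z))) D (oneChart E' K 1) := by
  have hd : ContDiffAt ℝ ∞ (fun z => oneChart E G (ι ((oneChart E' K).symm z)))
      (oneChart E' K 1) := by
    refine ContMDiffAt.contDiffAt_oneChart (contMDiffAt_hom_oneChart_symm hι
      ((oneChart E' K).map_source one_mem_oneChart_source)) ?_
    rw [oneChart_symm_one, map_one]
    exact one_mem_oneChart_source
  have hf := (hd.differentiableAt (by simp)).hasFDerivAt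
  rwa [show fderiv ℝ _ _ = D from
    (ContinuousLinearMap.ext fun v => hD ▸ mfderiv_eq_fderiv_extChartAt (y := (1 : G)) (map_one ι)
      (hι.mdifferentiable (by simp) 1) v).symm] at hf

/-- A smooth homomorphism maps right velocities by its derivative at the identity. -/
theorem HasRightVelocity.map {E' K : Type*} [NormedAddCommGroup E'] [NormedSpace ℝ E']
    [TopologicalSpace K] [ChartedSpace E' K] [Group K] [LieGroup 𝓘(ℝ, E') ∞ K]
    {ι : K →* G} (hι : ContMDiff 𝓘(ℝ, E') 𝓘(ℝ, E) ∞ ι) {D : E' →L[ℝ] E}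
    (hD : D = mfderiv 𝓘(ℝ, E') 𝓘(ℝ, E) ι 1) {γ : ℝ → K} {a : E'} {t : ℝ}
    (h : HasRightVelocity γ a t) : HasRightVelocity (fun s => ι (γ s)) (D a) t := by
  refine ⟨hι.continuous.continuousAt.comp h.continuousAt, ?_⟩
  have hf := hasFDerivAt_hom hι hD
  rw [show oneChart E' K 1 = oneChart E' K (γ t * (γ t)⁻¹) by rw [mul_inv_cancel]] at hf
  refine (HasFDerivAt.comp_hasDerivAt (f := fun s => oneChart E' K (γ s * (γ t)⁻¹)) t hf
    h.hasDerivAt).congr_of_eventuallyEq ?_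
  filter_upwards [h.continuousAt_mul_inv.eventually_mem_oneChart_source (E := E')
    (mul_inv_cancel _)]
    with s hs
  rw [Function.comp_apply, (oneChart E' K).left_inv hs, map_mul, map_inv]

/-- A smooth curve has a right velocity, which depends continuously on time. -/
theorem ContMDiffOn.exists_hasRightVelocity {γ : ℝ → G} {J : Set ℝ} (hJ : IsOpen J)
    (hγ : ContMDiffOn 𝓘(ℝ, ℝ) 𝓘(ℝ, E) ∞ γ J) :
    ∃ a : ℝ → E, ContinuousOn a J ∧ ∀ t ∈ J, HasRightVelocity γ (a t) t := by
  have hQ : ∀ t ∈ J, ContDiffAt ℝ ∞ (fun p : ℝ × ℝ => oneChart E G (γ p.1 * (γ p.2)⁻¹)) (t, t) := by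
    intro t ht
    have hγt : ContMDiffAt 𝓘(ℝ, ℝ) 𝓘(ℝ, E) ∞ γ t := hγ.contMDiffAt (hJ.mem_nhds ht)
    refine ContMDiffAt.contDiffAt_oneChart (ContMDiffAt.mul
      (ContMDiffAt.comp (f := Prod.fst) (t, t) hγt contDiffAt_fst.contMDiffAt) (ContMDiffAt.inv
      (ContMDiffAt.comp (f := Prod.snd) (t, t) hγt contDiffAt_snd.contMDiffAt))) ?_
    simp only [mul_inv_cancel]
    exact one_mem_oneChart_source
  refine ⟨fun t => fderiv ℝ (fun p : ℝ × ℝ => oneChart E G (γ p.1 * (γ p.2)⁻¹)) (t, t) (1, 0),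
    fun t ht => ContinuousAt.continuousWithinAt ?_, fun t ht => ⟨?_, ?_⟩⟩
  · have h1 := ((hQ t ht).fderiv_right (m := 0) (by simp)).continuousAt
    exact (ContinuousAt.comp (f := fun t : ℝ => (t, t)) h1 (by fun_prop)).clm_apply
      continuousAt_const
  · exact (hγ.contMDiffAt (hJ.mem_nhds ht)).continuousAt
  · have h1 := ((hQ t ht).differentiableAt (by simp)).hasFDerivAt
    exact HasFDerivAt.comp_hasDerivAt (f := fun s : ℝ => (s, t)) t h1
      ((hasDerivAt_id t).prodMk (hasDerivAt_const t t))

/-- A Banach Lie group is Hausdorff: charts make points closed, and a T₁ topological group is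
Hausdorff. Uniqueness of integral curves needs this. -/
theorem t2Space_of_lieGroup (E G : Type*) [NormedAddCommGroup E] [NormedSpace ℝ E]
    [TopologicalSpace G] [ChartedSpace E G] [Group G] [LieGroup 𝓘(ℝ, E) ∞ G] : T2Space G := by
  have : IsTopologicalGroup G := topologicalGroup_of_lieGroup 𝓘(ℝ, E) ∞
  have : T1Space G := ChartedSpace.t1Space E G
  infer_instance

theorem contMDiff_mulInvariantVectorField_one (X : GroupLieAlgebra 𝓘(ℝ, E) G) :
    ContMDiff 𝓘(ℝ, E) 𝓘(ℝ, E).tangent 1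
      (fun g : G => (⟨g, mulInvariantVectorField X g⟩ : TangentBundle 𝓘(ℝ, E) G)) := by
  have : LieGroup 𝓘(ℝ, E) (minSmoothness ℝ 3) G :=
    LieGroup.of_le (n := ∞) (by
      rw [minSmoothness_of_isRCLikeNormedField]; exact WithTop.coe_le_coe.2 le_top)
  refine (contMDiff_mulInvariantVectorField X).of_le ?_
  rw [minSmoothness_of_isRCLikeNormedField]
  exact one_le_two

theorem mfderiv_mul_left_mulInvariantVectorField (X : GroupLieAlgebra 𝓘(ℝ, E) G) (g h : G) :
    mfderiv 𝓘(ℝ, E) 𝓘(ℝ, E) (g * ·) h (mulInvariantVectorField X h) =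
      mulInvariantVectorField X (g * h) := by
  have hL (g h : G) : MDifferentiableAt 𝓘(ℝ, E) 𝓘(ℝ, E) (g * ·) h :=
    (contMDiff_mul_left (I := 𝓘(ℝ, E)) (n := ∞)).mdifferentiable (by simp) h
  have e := mfderiv_comp_apply (1 : G) (hL g (h * 1)) (hL h 1) X
  have e2 : (g * ·) ∘ (h * ·) = fun x : G => g * h * x := by
    ext x; simp [mul_assoc]
  rw [e2] at e
  let Y : E := mfderiv 𝓘(ℝ, E) 𝓘(ℝ, E) (h * ·) (1 : G) X
  have e3 : ∀ k : G, k = h → (mfderiv 𝓘(ℝ, E) 𝓘(ℝ, E) (g * ·) h : E →L[ℝ] E) Y =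
      (mfderiv 𝓘(ℝ, E) 𝓘(ℝ, E) (g * ·) k : E →L[ℝ] E) Y := by
    rintro _ rfl; rfl
  exact (e3 (h * 1) (mul_one h)).trans e.symm

theorem IsMIntegralCurveOn.mul_left {X : GroupLieAlgebra 𝓘(ℝ, E) G} {γ : ℝ → G} {s : Set ℝ}
    (h : IsMIntegralCurveOn (I := 𝓘(ℝ, E)) γ (mulInvariantVectorField X) s) (g : G) :
    IsMIntegralCurveOn (I := 𝓘(ℝ, E)) (fun t => g * γ t) (mulInvariantVectorField X) s := by
  intro t ht
  have hL : MDifferentiableAt 𝓘(ℝ, E) 𝓘(ℝ, E) (g * ·) (γ t) :=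
    (contMDiff_mul_left (I := 𝓘(ℝ, E)) (n := ∞)).mdifferentiable (by simp) _
  let D : E →L[ℝ] E := mfderiv 𝓘(ℝ, E) 𝓘(ℝ, E) (g * ·) (γ t)
  let v : E := mulInvariantVectorField (I := 𝓘(ℝ, E)) (G := G) X (γ t)
  have h1 : ∀ A : ℝ →L[ℝ] E, A = D.comp ((1 : ℝ →L[ℝ] ℝ).smulRight v) →
      HasMFDerivWithinAt 𝓘(ℝ, ℝ) 𝓘(ℝ, E) (fun t => g * γ t) s t A := by
    rintro _ rfl
    exact hL.hasMFDerivAt.comp_hasMFDerivWithinAt t (h t ht)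
  have e (D : E →L[ℝ] E) (v : E) : (1 : ℝ →L[ℝ] ℝ).smulRight (D v) =
      D.comp ((1 : ℝ →L[ℝ] ℝ).smulRight v) := by
    ext; simp
  rw [← mfderiv_mul_left_mulInvariantVectorField]
  exact h1 _ (e D v)

/-- The one-parameter subgroup with velocity `X`, as a global integral curve of the left-invariant
vector field: local integral curves exist for a uniform time, by translation. -/
theorem exists_isMIntegralCurve_mulInvariantVectorField [CompleteSpace E]
    (X : GroupLieAlgebra 𝓘(ℝ, E) G) :
    ∃ γ : ℝ → G, γ 0 = 1 ∧ IsMIntegralCurve (I := 𝓘(ℝ, E)) γ (mulInvariantVectorField X) := by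
  have := t2Space_of_lieGroup E G
  have hX := contMDiff_mulInvariantVectorField_one X
  obtain ⟨γ, h0, hγ⟩ := exists_isMIntegralCurveAt_of_contMDiffAt_boundaryless 0
    (hX.contMDiffAt (x := (1 : G)))
  obtain ⟨ε, hε, hγ⟩ := isMIntegralCurveAt_iff'.1 hγ
  rw [Real.ball_zero_eq_Ioo] at hγ
  exact exists_isMIntegralCurve_of_isMIntegralCurveOn hX hε
    (fun g => ⟨fun t => g * γ t, (congrArg (g * ·) h0).trans (mul_one g), hγ.mul_left g⟩) 1

theorem isMIntegralCurve_eq {X : GroupLieAlgebra 𝓘(ℝ, E) G} {γ δ : ℝ → G}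
    (hγ : IsMIntegralCurve (I := 𝓘(ℝ, E)) γ (mulInvariantVectorField X))
    (hδ : IsMIntegralCurve (I := 𝓘(ℝ, E)) δ (mulInvariantVectorField X)) (h : γ 0 = δ 0) :
    γ = δ :=
  have := t2Space_of_lieGroup E G
  isMIntegralCurve_Ioo_eq_of_contMDiff_boundaryless (contMDiff_mulInvariantVectorField_one X)
    hγ hδ h

theorem lieExp_eq {X : GroupLieAlgebra 𝓘(ℝ, E) G} {γ : ℝ → G} (h0 : γ 0 = 1)
    (hγ : IsMIntegralCurve (I := 𝓘(ℝ, E)) γ (mulInvariantVectorField X)) :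
    lieExp X = γ 1 := by
  have h := Classical.epsilon_spec (p := fun γ : ℝ → G =>
    γ 0 = 1 ∧ IsMIntegralCurve (I := 𝓘(ℝ, E)) γ (mulInvariantVectorField X)) ⟨γ, h0, hγ⟩
  rw [lieExp, isMIntegralCurve_eq h.2 hγ (h.1.trans h0.symm)]

theorem lieExp_smul_eq {X : GroupLieAlgebra 𝓘(ℝ, E) G} {γ : ℝ → G} (h0 : γ 0 = 1)
    (hγ : IsMIntegralCurve (I := 𝓘(ℝ, E)) γ (mulInvariantVectorField X)) (t : ℝ) :
    lieExp (t • X) = γ t := by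
  rw [lieExp_eq (γ := γ ∘ (· * t)) (by simp [h0]) ?_]
  · simp
  · have := hγ.comp_mul t
    rwa [mulInvariantVectorField_smul]

theorem IsMIntegralCurve.mul_add {X : GroupLieAlgebra 𝓘(ℝ, E) G} {γ : ℝ → G} (h0 : γ 0 = 1)
    (hγ : IsMIntegralCurve (I := 𝓘(ℝ, E)) γ (mulInvariantVectorField X)) (s t : ℝ) :
    γ (s + t) = γ s * γ t := by
  have h1 := hγ.comp_add s
  have h2 : IsMIntegralCurve (I := 𝓘(ℝ, E)) (fun t => γ s * γ t) (mulInvariantVectorField X) :=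
    isMIntegralCurve_iff_isMIntegralCurveOn.2
      ((isMIntegralCurve_iff_isMIntegralCurveOn.1 hγ).mul_left _)
  have := congrFun (isMIntegralCurve_eq h1 h2 (by simp [h0])) t
  simpa [add_comm] using this

/-- Where a one-parameter subgroup lies in the domain of the chart at the identity, it is in that
chart an integral curve of the left-invariant vector field. -/
theorem IsMIntegralCurve.hasDerivAt_oneChart {X : E} {γ : ℝ → G}
    (hγ : IsMIntegralCurve (I := 𝓘(ℝ, E)) γ (mulInvariantVectorField (I := 𝓘(ℝ, E)) (G := G) X))
    {t : ℝ} (ht : γ t ∈ (oneChart E G).source) :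
    HasDerivAt (fun s => oneChart E G (γ s)) (chartLeftField G X (oneChart E G (γ t))) t := by
  have hC := ((contMDiffAt_oneChart ht).mdifferentiableAt (by simp)).hasMFDerivAt
  let D : E →L[ℝ] E := mfderiv 𝓘(ℝ, E) 𝓘(ℝ, E) (oneChart E G) (γ t)
  let v : E := mulInvariantVectorField (I := 𝓘(ℝ, E)) (G := G) X (γ t)
  have h : HasFDerivAt (fun s => oneChart E G (γ s)) (D.comp ((1 : ℝ →L[ℝ] ℝ).smulRight v)) t :=
    hasMFDerivAt_iff_hasFDerivAt.1 (hC.comp t (hγ t))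
  rw [← mfderiv_oneChart_mulInvariantVectorField X ht]
  refine h.hasDerivAt.congr_deriv ?_
  change D ((1 : ℝ) • v) = D v
  rw [one_smul]

theorem IsMIntegralCurve.hasRightVelocity {X : E} {γ : ℝ → G} (h0 : γ 0 = 1)
    (hγ : IsMIntegralCurve (I := 𝓘(ℝ, E)) γ (mulInvariantVectorField (I := 𝓘(ℝ, E)) (G := G) X))
    (t : ℝ) : HasRightVelocity γ X t := by
  refine ⟨hγ.continuous.continuousAt, ?_⟩
  have e : ∀ s, γ s * (γ t)⁻¹ = γ (s - t) := fun s => by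
    rw [mul_inv_eq_iff_eq_mul, ← hγ.mul_add h0, sub_add_cancel]
  simp only [e]
  have h1 := hγ.hasDerivAt_oneChart (t := t - t)
    (by rw [sub_self, h0]; exact one_mem_oneChart_source)
  have h2 : chartLeftField G X (oneChart E G (γ (t - t))) = X := by
    rw [sub_self, h0]; exact fderiv_chartMul_one_inr X
  rw [h2] at h1
  exact h1.comp_sub_const t t

/-- A one-parameter subgroup is smooth, as an integral curve of a smooth vector field. -/
theorem IsMIntegralCurve.contDiffAt_oneChart [CompleteSpace E] {X : E} {γ : ℝ → G}
    (hγ : IsMIntegralCurve (I := 𝓘(ℝ, E)) γ (mulInvariantVectorField (I := 𝓘(ℝ, E)) (G := G) X))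
    {t : ℝ} (ht : γ t ∈ (oneChart E G).source) :
    ContDiffAt ℝ ∞ (fun s => oneChart E G (γ s)) t := by
  have hU : γ ⁻¹' (oneChart E G).source ∈ 𝓝 t :=
    hγ.continuous.continuousAt.preimage_mem_nhds
      ((isOpen_extChartAt_source (I := 𝓘(ℝ, E)) (1 : G)).mem_nhds ht)
  obtain ⟨a, b, hab, hmem, hsub⟩ := exists_Icc_mem_subset_of_mem_nhds hU
  have h := ODE.contDiffOn_enat_Icc_of_hasDerivWithinAt (n := ⊤) (α := fun s => oneChart E G (γ s))
    (f := fun _ => chartLeftField G X) (u := (oneChart E G).target) (tmin := a) (tmax := b)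
    ((contDiffOn_chartLeftField X).comp contDiff_snd.contDiffOn fun p hp => hp.2)
    (fun s hs => (hγ.hasDerivAt_oneChart (hsub hs)).hasDerivWithinAt)
    (fun s hs => (oneChart E G).map_source (hsub hs))
  exact h.contDiffAt hmem

/-- The exponential of `t X` has right velocity `X`. -/
theorem hasRightVelocity_lieExp [CompleteSpace E] (X : E) (t : ℝ) :
    HasRightVelocity (fun s : ℝ => (lieExp (s • X : GroupLieAlgebra 𝓘(ℝ, E) G) : G)) X t := by
  obtain ⟨γ, h0, hγ⟩ := exists_isMIntegralCurve_mulInvariantVectorField (E := E) (G := G) X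
  have e : (fun s : ℝ => (lieExp (s • X : GroupLieAlgebra 𝓘(ℝ, E) G) : G)) = γ :=
    funext (lieExp_smul_eq h0 hγ)
  rw [e]
  exact hγ.hasRightVelocity h0 t

theorem lieExp_zero_smul [CompleteSpace E] (X : E) :
    (lieExp ((0 : ℝ) • X : GroupLieAlgebra 𝓘(ℝ, E) G) : G) = 1 := by
  obtain ⟨γ, h0, hγ⟩ := exists_isMIntegralCurve_mulInvariantVectorField (E := E) (G := G) X
  exact (lieExp_smul_eq h0 hγ 0).trans h0

/-- The smooth local inverse of a smooth map between Banach spaces at a point where the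
derivative is invertible. -/
theorem exists_localInverse {F F' : Type*} [NormedAddCommGroup F] [NormedSpace ℝ F]
    [CompleteSpace F] [NormedAddCommGroup F'] [NormedSpace ℝ F'] [CompleteSpace F']
    {f : F → F'} {p : F} (f' : F ≃L[ℝ] F') (hf : ∀ᶠ q in 𝓝 p, ContDiffAt ℝ ∞ f q)
    (hf' : HasFDerivAt f (f' : F →L[ℝ] F') p) :
    ∃ g : F' → F, g (f p) = p ∧ ∀ᶠ z in 𝓝 (f p), f (g z) = z ∧ ContDiffAt ℝ ∞ g z := by
  have hp := hf.self_of_nhds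
  set Φ := hp.toOpenPartialHomeomorph f hf' (by simp) with hΦ
  have hpsrc : p ∈ Φ.source := hp.mem_toOpenPartialHomeomorph_source hf' (by simp)
  have hcoe : (Φ : F → F') = f := hp.toOpenPartialHomeomorph_coe hf' (by simp)
  have hsymm : Φ.symm (f p) = p := by rw [← hcoe]; exact Φ.left_inv hpsrc
  have htgt : f p ∈ Φ.target := by rw [← hcoe]; exact Φ.map_source hpsrc
  refine ⟨Φ.symm, hsymm, ?_⟩
  -- invertibility of the derivative is an open condition
  have hinv : ∀ᶠ q in 𝓝 p, fderiv ℝ f q ∈ range ((↑) : (F ≃L[ℝ] F') → F →L[ℝ] F') := by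
    refine ((hp.fderiv_right (m := 0) (by simp)).continuousAt).eventually ?_
    rw [hf'.fderiv]
    exact ContinuousLinearEquiv.nhds f'
  have hcont : Tendsto Φ.symm (𝓝 (f p)) (𝓝 p) := by
    simpa only [ContinuousAt, hsymm] using Φ.symm.continuousAt htgt
  filter_upwards [Φ.open_target.mem_nhds htgt, hcont.eventually (hf.and hinv)] with z hz hz2
  obtain ⟨hz2, L, hL⟩ := hz2
  refine ⟨by rw [← hcoe]; exact Φ.right_inv hz, Φ.contDiffAt_symm (f₀' := L) hz ?_ ?_⟩
  · rw [hL, hcoe]; exact (hz2.differentiableAt (by simp)).hasFDerivAt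
  · rwa [hcoe]

end Curves

/-! ### Local factorization along complementary subgroups -/

section Factorization

open Filter Topology

variable {E : Type*} [NormedAddCommGroup E] [NormedSpace ℝ E]
  {G : Type*} [TopologicalSpace G] [ChartedSpace E G] [Group G] [LieGroup 𝓘(ℝ, E) ∞ G]
  {E₁ : Type*} [NormedAddCommGroup E₁] [NormedSpace ℝ E₁]
  {K₁ : Type*} [TopologicalSpace K₁] [ChartedSpace E₁ K₁] [Group K₁] [LieGroup 𝓘(ℝ, E₁) ∞ K₁]
  {E₂ : Type*} [NormedAddCommGroup E₂] [NormedSpace ℝ E₂]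
  {K₂ : Type*} [TopologicalSpace K₂] [ChartedSpace E₂ K₂] [Group K₂] [LieGroup 𝓘(ℝ, E₂) ∞ K₂]

/-- The product map of two subgroups, in the charts at the identities, has the sum of the two
derivatives as its derivative. -/
theorem hasFDerivAt_mul_hom {ι₁ : K₁ →* G} (hι₁ : ContMDiff 𝓘(ℝ, E₁) 𝓘(ℝ, E) ∞ ι₁)
    {ι₂ : K₂ →* G} (hι₂ : ContMDiff 𝓘(ℝ, E₂) 𝓘(ℝ, E) ∞ ι₂) {D₁ : E₁ →L[ℝ] E} {D₂ : E₂ →L[ℝ] E}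
    (hD₁ : D₁ = mfderiv 𝓘(ℝ, E₁) 𝓘(ℝ, E) ι₁ 1) (hD₂ : D₂ = mfderiv 𝓘(ℝ, E₂) 𝓘(ℝ, E) ι₂ 1) :
    HasFDerivAt (fun q : E₁ × E₂ => oneChart E G
      (ι₁ ((oneChart E₁ K₁).symm q.1) * ι₂ ((oneChart E₂ K₂).symm q.2))) (D₁.coprod D₂)
      (oneChart E₁ K₁ 1, oneChart E₂ K₂ 1) := by
  have h1 := HasFDerivAt.comp (f := Prod.fst) (oneChart E₁ K₁ 1, oneChart E₂ K₂ 1)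
    (hasFDerivAt_hom hι₁ hD₁) hasFDerivAt_fst
  have h2 := HasFDerivAt.comp (f := Prod.snd) (oneChart E₁ K₁ 1, oneChart E₂ K₂ 1)
    (hasFDerivAt_hom hι₂ hD₂) hasFDerivAt_snd
  have hm : HasFDerivAt (chartMul (E := E) G)
      (fderiv ℝ (chartMul (E := E) G) (oneChart E G 1, oneChart E G 1))
      (oneChart E G (ι₁ ((oneChart E₁ K₁).symm (oneChart E₁ K₁ 1))),
        oneChart E G (ι₂ ((oneChart E₂ K₂).symm (oneChart E₂ K₂ 1)))) := by
    simp only [oneChart_symm_one, map_one]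
    exact (contDiffAt_chartMul_one.differentiableAt (by simp)).hasFDerivAt
  have h := HasFDerivAt.comp (f := fun q : E₁ × E₂ =>
    (oneChart E G (ι₁ ((oneChart E₁ K₁).symm q.1)), oneChart E G (ι₂ ((oneChart E₂ K₂).symm q.2))))
    (oneChart E₁ K₁ 1, oneChart E₂ K₂ 1) hm (h1.prodMk h2)
  refine (h.congr_fderiv ?_).congr_of_eventuallyEq ?_
  · ext v
    · simpa using fderiv_chartMul_one_inl (G := G) (D₁ v)
    · simpa using fderiv_chartMul_one_inr (G := G) (D₂ v)
  · have c1 : ContinuousAt (fun q : E₁ × E₂ => ι₁ ((oneChart E₁ K₁).symm q.1))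
        (oneChart E₁ K₁ 1, oneChart E₂ K₂ 1) :=
      ContinuousAt.comp (g := fun z => ι₁ ((oneChart E₁ K₁).symm z)) (f := Prod.fst)
        (contMDiffAt_hom_oneChart_symm hι₁
        ((oneChart E₁ K₁).map_source one_mem_oneChart_source)).continuousAt continuousAt_fst
    have c2 : ContinuousAt (fun q : E₁ × E₂ => ι₂ ((oneChart E₂ K₂).symm q.2))
        (oneChart E₁ K₁ 1, oneChart E₂ K₂ 1) :=
      ContinuousAt.comp (g := fun z => ι₂ ((oneChart E₂ K₂).symm z)) (f := Prod.snd)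
        (contMDiffAt_hom_oneChart_symm hι₂
        ((oneChart E₂ K₂).map_source one_mem_oneChart_source)).continuousAt continuousAt_snd
    filter_upwards [c1.eventually_mem_oneChart_source (E := E) (by rw [oneChart_symm_one, map_one]),
      c2.eventually_mem_oneChart_source (E := E)
        (by rw [oneChart_symm_one, map_one])] with q hq1 hq2
    simp only [Function.comp_apply, chartMul]
    rw [(oneChart E G).left_inv hq1, (oneChart E G).left_inv hq2]

/-- If the Lie algebras of two Lie subgroups are complementary, then the product map of the two
subgroups is a local diffeomorphism at the identity, so that small elements of one-parameter
subgroups factorize smoothly. -/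
theorem exists_isFactorization [CompleteSpace E] [CompleteSpace E₁] [CompleteSpace E₂]
    {ι₁ : K₁ →* G} (hι₁ : ContMDiff 𝓘(ℝ, E₁) 𝓘(ℝ, E) ∞ ι₁)
    {ι₂ : K₂ →* G} (hι₂ : ContMDiff 𝓘(ℝ, E₂) 𝓘(ℝ, E) ∞ ι₂) {D₁ : E₁ →L[ℝ] E} {D₂ : E₂ →L[ℝ] E}
    (hD₁ : D₁ = mfderiv 𝓘(ℝ, E₁) 𝓘(ℝ, E) ι₁ 1) (hD₂ : D₂ = mfderiv 𝓘(ℝ, E₂) 𝓘(ℝ, E) ι₂ 1)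
    (hD : Function.Bijective (D₁.coprod D₂)) (X : GroupLieAlgebra 𝓘(ℝ, E) G) :
    ∃ ε > 0, ∃ (gp : ℝ → K₁) (gm : ℝ → K₂),
      IsFactorization E₁ E₂ ι₁ ι₂ X (Ioo (-ε) ε) gp gm := by
  obtain ⟨γ, h0, hγ⟩ := exists_isMIntegralCurve_mulInvariantVectorField X
  set p : E₁ × E₂ := (oneChart E₁ K₁ 1, oneChart E₂ K₂ 1) with hp
  set N : E₁ × E₂ → G := fun q => ι₁ ((oneChart E₁ K₁).symm q.1) * ι₂ ((oneChart E₂ K₂).symm q.2)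
    with hN
  have hNp : N p = 1 := by simp only [hN, hp, oneChart_symm_one, map_one, mul_one]
  have t1 : ∀ᶠ q : E₁ × E₂ in 𝓝 p, q.1 ∈ (oneChart E₁ K₁).target :=
    continuousAt_fst.eventually (eventually_mem_oneChart_target (E := E₁) (G := K₁))
  have t2 : ∀ᶠ q : E₁ × E₂ in 𝓝 p, q.2 ∈ (oneChart E₂ K₂).target :=
    continuousAt_snd.eventually (eventually_mem_oneChart_target (E := E₂) (G := K₂))
  have hNs : ∀ q : E₁ × E₂, q.1 ∈ (oneChart E₁ K₁).target → q.2 ∈ (oneChart E₂ K₂).target →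
      ContMDiffAt 𝓘(ℝ, E₁ × E₂) 𝓘(ℝ, E) ∞ N q := fun q h1 h2 =>
    ContMDiffAt.mul
      (ContMDiffAt.comp (f := Prod.fst) q (contMDiffAt_hom_oneChart_symm hι₁ h1)
        contDiffAt_fst.contMDiffAt)
      (ContMDiffAt.comp (f := Prod.snd) q (contMDiffAt_hom_oneChart_symm hι₂ h2)
        contDiffAt_snd.contMDiffAt)
  have t3 : ∀ᶠ q in 𝓝 p, N q ∈ (oneChart E G).source :=
    (hNs p t1.self_of_nhds t2.self_of_nhds).continuousAt.eventually_mem_oneChart_source hNp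
  have hF : ∀ᶠ q in 𝓝 p, ContDiffAt ℝ ∞ (fun q => oneChart E G (N q)) q := by
    filter_upwards [t1, t2, t3] with q h1 h2 h3
    exact (hNs q h1 h2).contDiffAt_oneChart h3
  let L : (E₁ × E₂) ≃L[ℝ] E := ContinuousLinearEquiv.ofBijective (D₁.coprod D₂)
    (LinearMap.ker_eq_bot.2 hD.1) (LinearMap.range_eq_top.2 hD.2)
  have hL : HasFDerivAt (fun q => oneChart E G (N q)) (L : (E₁ × E₂) →L[ℝ] E) p := by
    rw [ContinuousLinearEquiv.coe_ofBijective]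
    exact hasFDerivAt_mul_hom hι₁ hι₂ hD₁ hD₂
  -- `g` is a smooth local inverse of the product map in the charts
  obtain ⟨g, hg0, hg⟩ := exists_localInverse L hF hL
  rw [hNp] at hg0 hg
  have s1 : ∀ᶠ t in 𝓝 (0 : ℝ), γ t ∈ (oneChart E G).source :=
    hγ.continuous.continuousAt.eventually_mem_oneChart_source h0
  have s2 : ContinuousAt (fun t => oneChart E G (γ t)) 0 :=
    (hγ.contDiffAt_oneChart s1.self_of_nhds).continuousAt
  have e0 : oneChart E G (γ 0) = oneChart E G 1 := by rw [h0]
  have s3 := s2.eventually (e0 ▸ hg)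
  have s4 : Tendsto (fun t => g (oneChart E G (γ t))) (𝓝 0) (𝓝 p) := by
    have := (hg.self_of_nhds.2.continuousAt).tendsto
    rw [hg0, ← e0] at this
    exact this.comp s2
  obtain ⟨ε, hε, hball⟩ := Metric.eventually_nhds_iff_ball.1
    ((s1.and s3).and (s4.eventually (t1.and (t2.and t3))))
  rw [Real.ball_zero_eq_Ioo] at hball
  have hs (t : ℝ) (ht : t ∈ Ioo (-ε) ε) :
      ContDiffAt ℝ ∞ (fun t => g (oneChart E G (γ t))) t :=
    ContDiffAt.comp (f := fun t => oneChart E G (γ t)) t (hball t ht).1.2.2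
      (hγ.contDiffAt_oneChart (hball t ht).1.1)
  refine ⟨ε, hε, fun t => ((oneChart E₁ K₁).symm (g (oneChart E G (γ t))).1)⁻¹,
    fun t => (oneChart E₂ K₂).symm (g (oneChart E G (γ t))).2, ?_, ?_, ?_, ?_, ?_⟩
  · intro t ht
    exact (ContDiffAt.contMDiffAt_oneChart_symm (contDiffAt_fst.comp t (hs t ht))
      (hball t ht).2.1).inv.contMDiffWithinAt
  · intro t ht
    exact (ContDiffAt.contMDiffAt_oneChart_symm (contDiffAt_snd.comp t (hs t ht))
      (hball t ht).2.2.1).contMDiffWithinAt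
  · simp only [h0, hg0, hp, oneChart_symm_one, inv_one]
  · simp only [h0, hg0, hp, oneChart_symm_one]
  · intro t ht
    rw [lieExp_smul_eq h0 hγ, map_inv, inv_inv]
    exact ((oneChart E G).injOn (hball t ht).2.2.2 (hball t ht).1.1 (hball t ht).1.2.1).symm

end Factorization

/-! ### Coadjoint flows and invariant functions -/

section LiePoissonFlow

open Filter Topology

variable {𝔤 : Type*} [NormedAddCommGroup 𝔤] [NormedSpace ℝ 𝔤]
  {𝔟 : Type*} [NormedAddCommGroup 𝔟] [NormedSpace ℝ 𝔟]
  {B : 𝔟 →L[ℝ] 𝔤 →L[ℝ] ℝ} {L : BanachLieBracket 𝔤} {A : 𝔤 →L[ℝ] 𝔟 →L[ℝ] 𝔟} {H : 𝔟 → ℝ}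

/-- `A a = -ad*_a`, the infinitesimal coadjoint action of `𝔤` on `𝔟`. -/
def IsCoadjointOperator (B : 𝔟 →L[ℝ] 𝔤 →L[ℝ] ℝ) (L : BanachLieBracket 𝔤)
    (A : 𝔤 →L[ℝ] 𝔟 →L[ℝ] 𝔟) : Prop :=
  ∀ a x y, B (A a x) y = -B x (L.br a y)

theorem norm_smul_div_two_norm_lt {V : Type*} [NormedAddCommGroup V] [NormedSpace ℝ V] {δ : ℝ}
    (hδ : 0 < δ) {v : V} (hv : v ≠ 0) : ‖(δ / (2 * ‖v‖)) • v‖ < δ := by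
  have hv' := norm_pos_iff.2 hv
  rw [norm_smul, Real.norm_of_nonneg (by positivity)]
  field_simp
  linarith

/-- A jointly continuous coadjoint action is a bounded bilinear map. -/
theorem IsBanachLiePoisson.exists_isCoadjointOperator (h : IsBanachLiePoisson B L) :
    ∃ A : 𝔤 →L[ℝ] 𝔟 →L[ℝ] 𝔟, IsCoadjointOperator B L A := by
  obtain ⟨f, hf, hcont⟩ := h.coad
  have hinj := h.pairing.injective_left
  have smul_both (r s : ℝ) (a : 𝔤) (x : 𝔟) : f (r • a) (s • x) = (r * s) • f a x :=
    hinj (by ext y; simp [hf]; ring)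
  let f' : 𝔤 →ₗ[ℝ] 𝔟 →ₗ[ℝ] 𝔟 := LinearMap.mk₂ ℝ f
    (fun a b x => hinj (by ext y; simp [hf])) (fun r a x => hinj (by ext y; simp [hf]))
    (fun a x y => hinj (by ext y; simp [hf])) (fun r a x => hinj (by ext y; simp [hf]))
  have h0 : f 0 0 = 0 := by simpa using smul_both 0 0 0 0
  -- continuity at the origin and bihomogeneity give the bound
  obtain ⟨δ, hδ, hb⟩ := Metric.continuousAt_iff.1 (hcont.continuousAt (x := (0, 0))) 1 one_pos
  have bound : ∀ a x, ‖f' a x‖ ≤ (4 / δ ^ 2) * ‖a‖ * ‖x‖ := by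
    intro a x
    change ‖f a x‖ ≤ _
    rcases eq_or_ne a 0 with rfl | ha
    · have : f 0 x = 0 := by simpa using smul_both 0 1 0 x
      simp [this]
    rcases eq_or_ne x 0 with rfl | hx
    · have : f a 0 = 0 := by simpa using smul_both 1 0 a 0
      simp [this]
    have ha' := norm_pos_iff.2 ha
    have hx' := norm_pos_iff.2 hx
    have := @hb ((δ / (2 * ‖a‖)) • a, (δ / (2 * ‖x‖)) • x) (by
      rw [dist_eq_norm, Prod.mk_sub_mk, sub_zero, sub_zero, Prod.norm_def]
      exact max_lt (norm_smul_div_two_norm_lt hδ ha) (norm_smul_div_two_norm_lt hδ hx))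
    simp only [h0, smul_both] at this
    rw [dist_zero_right, norm_smul, Real.norm_of_nonneg (by positivity)] at this
    have e : δ / (2 * ‖a‖) * (δ / (2 * ‖x‖)) * ‖f a x‖ = δ ^ 2 / (4 * ‖a‖ * ‖x‖) * ‖f a x‖ := by
      field_simp; ring
    rw [e, div_mul_eq_mul_div, div_lt_one (by positivity)] at this
    rw [div_mul_eq_mul_div, div_mul_eq_mul_div, le_div_iff₀ (by positivity)]
    linarith
  refine ⟨-(f'.mkContinuous₂ (4 / δ ^ 2) bound), fun a x y => ?_⟩
  have : B (f a x) y = B x (L.br a y) := by rw [hf]; rfl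
  simp only [neg_apply, LinearMap.mkContinuous₂_apply, map_neg, ← this]
  rfl

/-- The coadjoint flow of a time-dependent element `a` of the Lie algebra on a compact interval
`[α, β]`: the propagator of the linear equation `u' = -ad*_a u`, starting at `t₀`. -/
structure IsCoadjointFlow (A : 𝔤 →L[ℝ] 𝔟 →L[ℝ] 𝔟) (a : ℝ → 𝔤) (α β t₀ : ℝ)
    (U : ℝ → 𝔟 →L[ℝ] 𝔟) : Prop where
  init : U t₀ = ContinuousLinearMap.id ℝ 𝔟
  deriv : ∀ t ∈ Icc α β, ∀ x, HasDerivWithinAt (fun s => U s x) (A (a t) (U t x)) (Icc α β) t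
  surjective : ∀ t ∈ Icc α β, Function.Surjective (U t)

variable {a : ℝ → 𝔤} {α β t₀ : ℝ} {U : ℝ → 𝔟 →L[ℝ] 𝔟}

theorem exists_isCoadjointFlow [CompleteSpace 𝔟] (A : 𝔤 →L[ℝ] 𝔟 →L[ℝ] 𝔟)
    (ha : ContinuousOn a (Icc α β)) (ht₀ : t₀ ∈ Icc α β) :
    ∃ U, IsCoadjointFlow A a α β t₀ U := by
  obtain ⟨U, h1, h2, h3⟩ := exists_propagator (A.continuous.comp_continuousOn ha) ht₀
  exact ⟨U, h1, h2, h3⟩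

theorem eq_of_hasDerivWithinAt_zero {F : Type*} [NormedAddCommGroup F] [NormedSpace ℝ F]
    {f : ℝ → F} (hf : ∀ t ∈ Icc α β, HasDerivWithinAt f 0 (Icc α β) t) (ht₀ : t₀ ∈ Icc α β)
    {t : ℝ} (ht : t ∈ Icc α β) : f t = f t₀ :=
  linearODE_unique (A := fun _ => 0) (v := fun _ => f t₀) continuousOn_const ht₀ hf
    (fun t _ => hasDerivWithinAt_const t _ _) rfl ht

/-- The pairing is preserved when the coadjoint equation in `𝔟` and the adjoint equation in `𝔤`
are solved simultaneously. -/
theorem IsCoadjointFlow.pairing_eq (hU : IsCoadjointFlow A a α β t₀ U)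
    (hA : IsCoadjointOperator B L A) (ht₀ : t₀ ∈ Icc α β) {w : ℝ → 𝔤}
    (hw : ∀ t ∈ Icc α β, HasDerivWithinAt w (L.br (a t) (w t)) (Icc α β) t) (x : 𝔟) {t : ℝ}
    (ht : t ∈ Icc α β) : B (U t x) (w t) = B x (w t₀) := by
  have := eq_of_hasDerivWithinAt_zero (f := fun t => B (U t x) (w t)) (fun s hs => by
    have h1 := (B.hasFDerivAt.comp_hasDerivWithinAt s (hU.deriv s hs x)).clm_apply (hw s hs)
    refine h1.congr_deriv ?_
    rw [Function.comp_apply, hA, neg_add_cancel]) ht₀ ht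
  simpa [hU.init] using this

/-- Infinitesimal invariance of `H` under the coadjoint action of `𝔤`. -/
def IsInfinitesimallyInvariant (B : 𝔟 →L[ℝ] 𝔤 →L[ℝ] ℝ) (L : BanachLieBracket 𝔤) (H : 𝔟 → ℝ) :
    Prop :=
  ∀ x X, B x (L.br X (diffAt B H x)) = 0

theorem IsInfinitesimallyInvariant.apply_left (hinf : IsInfinitesimallyInvariant B L H) (x : 𝔟)
    (X : 𝔤) : B x (L.br (diffAt B H x) X) = 0 := by
  rw [L.skew, map_neg, hinf, neg_zero]

theorem hasFDerivAt_of_mem_admissibleFunctions (hH : H ∈ admissibleFunctions B) (x : 𝔟) :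
    HasFDerivAt H (B.flip (diffAt B H x)) x := by
  rw [← fderiv_eq_diffAt hH]
  exact (hH.1.differentiable (by simp) x).hasFDerivAt

/-- An infinitesimally invariant function is constant along coadjoint flows. -/
theorem IsCoadjointFlow.apply_eq (hU : IsCoadjointFlow A a α β t₀ U)
    (hA : IsCoadjointOperator B L A) (ht₀ : t₀ ∈ Icc α β) (hH : H ∈ admissibleFunctions B)
    (hinf : IsInfinitesimallyInvariant B L H) (x : 𝔟) {t : ℝ} (ht : t ∈ Icc α β) :
    H (U t x) = H x := by
  have := eq_of_hasDerivWithinAt_zero (f := fun t => H (U t x)) (fun s hs => by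
    have h1 := (hasFDerivAt_of_mem_admissibleFunctions hH (U s x)).comp_hasDerivWithinAt s
      (hU.deriv s hs x)
    refine h1.congr_deriv ?_
    rw [ContinuousLinearMap.flip_apply, hA, hinf, neg_zero]) ht₀ ht
  simpa [hU.init] using this

/-- The differential of an invariant function is equivariant: along a coadjoint flow it is
transported by the adjoint equation `w' = [a, w]`. -/
theorem IsCoadjointFlow.diffAt_eq (hU : IsCoadjointFlow A a α β t₀ U)
    (hB : IsDualityPairing B) (hA : IsCoadjointOperator B L A) (ht₀ : t₀ ∈ Icc α β)
    (hH : H ∈ admissibleFunctions B) (hinf : IsInfinitesimallyInvariant B L H) (x : 𝔟) {w : ℝ → 𝔤}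
    (hw : ∀ t ∈ Icc α β, HasDerivWithinAt w (L.br (a t) (w t)) (Icc α β) t)
    (hw₀ : w t₀ = diffAt B H x) {t : ℝ} (ht : t ∈ Icc α β) : diffAt B H (U t x) = w t := by
  refine hB.injective_right ?_
  ext z'
  obtain ⟨z, rfl⟩ := hU.surjective t ht z'
  have h1 := (hasFDerivAt_of_mem_admissibleFunctions hH (U t x)).comp x (U t).hasFDerivAt
  have h2 : H ∘ U t = H := funext fun y => hU.apply_eq hA ht₀ hH hinf y ht
  rw [h2] at h1
  have h3 := congr($(h1.unique (hasFDerivAt_of_mem_admissibleFunctions hH x)) z)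
  refine h3.trans ?_
  change B z (diffAt B H x) = B (U t z) (w t)
  rw [hU.pairing_eq hA ht₀ hw z ht, hw₀]

/-- For an invariant function, the Hamiltonian vector field of the `R`-bracket at `x` is the
coadjoint action of the `𝔤₊`-component of `D_x H`. -/
theorem hamiltonianField_withR {𝔤p 𝔤m : Submodule ℝ 𝔤} (hL : L.IsSplitting 𝔤p 𝔤m)
    (hBR : IsBanachLiePoisson B (L.withR hL.R hL.isRMatrix)) (hA : IsCoadjointOperator B L A)
    (hinf : IsInfinitesimallyInvariant B L H) (x : 𝔟) :
    hamiltonianField B (L.withR hL.R hL.isRMatrix) H x =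
      A (𝔤p.projectionL 𝔤m hL.compl (diffAt B H x)) x := by
  refine hBR.pairing.injective_left ?_
  ext Y
  rw [(hamiltonianField_spec hBR H x).2, hA]
  change -B x (L.rBilin hL.R _ _) = _
  have k1 := hinf.apply_left x Y
  have k2 := hinf.apply_left x (hL.R Y)
  set M := diffAt B H x
  have e : M = 𝔤p.projectionL 𝔤m hL.compl M + 𝔤m.projectionL 𝔤p hL.compl.symm M := by
    simpa using (Submodule.projection_add_projection_eq_self hL.compl.isCompl M).symm
  -- `R = 2 p₊ - 1`, so that the `R`-bracket with `M` is `[p₊ M, Y]` up to `[M, Y]` and `[M, R Y]`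
  have e2 : hL.R M = (2 : ℝ) • 𝔤p.projectionL 𝔤m hL.compl M - M := by
    have e3 : 𝔤p.projectionL 𝔤m hL.compl M - 𝔤m.projectionL 𝔤p hL.compl.symm M + M =
        𝔤p.projectionL 𝔤m hL.compl M - 𝔤m.projectionL 𝔤p hL.compl.symm M +
          (𝔤p.projectionL 𝔤m hL.compl M + 𝔤m.projectionL 𝔤p hL.compl.symm M) := by rw [← e]
    rw [BanachLieBracket.IsSplitting.R, sub_apply, eq_sub_iff_add_eq, e3]
    module
  rw [L.rBilin_apply, e2]
  simp [k1, k2]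

/-- Integral curves along which `D H` is continuous are unique. The differential `M = D_ν H`
satisfies the Lax equation `M' = [p₊ M, M]`, whose solutions are determined by their initial
value; given `M`, the equation for `ν` is linear. -/
theorem eqOn_of_hasDerivWithinAt [CompleteSpace 𝔤] [CompleteSpace 𝔟] (hB : IsDualityPairing B)
    (hA : IsCoadjointOperator B L A)
    (hH : H ∈ admissibleFunctions B) (hinf : IsInfinitesimallyInvariant B L H) (p : 𝔤 →L[ℝ] 𝔤)
    (ht₀ : t₀ ∈ Icc α β) {μ ν : ℝ → 𝔟} (h₀ : μ t₀ = ν t₀)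
    (hμ : ∀ t ∈ Icc α β, HasDerivWithinAt μ (A (p (diffAt B H (μ t))) (μ t)) (Icc α β) t)
    (hν : ∀ t ∈ Icc α β, HasDerivWithinAt ν (A (p (diffAt B H (ν t))) (ν t)) (Icc α β) t)
    (hMμ : ContinuousOn (fun t => diffAt B H (μ t)) (Icc α β))
    (hMν : ContinuousOn (fun t => diffAt B H (ν t)) (Icc α β)) : EqOn μ ν (Icc α β) := by
  -- the Lax equation
  have lax : ∀ ν : ℝ → 𝔟,
      (∀ t ∈ Icc α β, HasDerivWithinAt ν (A (p (diffAt B H (ν t))) (ν t)) (Icc α β) t) →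
      ContinuousOn (fun t => diffAt B H (ν t)) (Icc α β) →
      ∀ t ∈ Icc α β, HasDerivWithinAt (fun t => diffAt B H (ν t))
        (L.br (p (diffAt B H (ν t))) (diffAt B H (ν t))) (Icc α β) t := by
    intro ν hν hM
    have ha : ContinuousOn (fun t => p (diffAt B H (ν t))) (Icc α β) :=
      p.continuous.comp_continuousOn hM
    obtain ⟨U, hU⟩ := exists_isCoadjointFlow A ha ht₀
    obtain ⟨w, hw₀, hw⟩ := linearODE_exists (A := fun t => L.br (p (diffAt B H (ν t))))
      (L.br.continuous.comp_continuousOn ha) ht₀ (diffAt B H (ν t₀))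
    have hνU : EqOn ν (fun t => U t (ν t₀)) (Icc α β) :=
      linearODE_unique (A.continuous.comp_continuousOn ha) ht₀ hν
        (fun t ht => hU.deriv t ht _) (by simp [hU.init])
    have hMw : ∀ t ∈ Icc α β, diffAt B H (ν t) = w t := fun t ht => by
      rw [hνU ht]
      exact hU.diffAt_eq hB hA ht₀ hH hinf _ hw hw₀ ht
    intro t ht
    have := (hw t ht).congr hMw (hMw t ht)
    rwa [← hMw t ht] at this
  have hM : EqOn (fun t => diffAt B H (μ t)) (fun t => diffAt B H (ν t)) (Icc α β) := by
    -- the difference of two solutions of the Lax equation solves a linear equation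
    have h1 := linearODE_unique
      (A := fun t => (L.br.flip (diffAt B H (μ t))).comp p + L.br (p (diffAt B H (ν t))))
      (u := fun t => diffAt B H (μ t) - diffAt B H (ν t)) (v := fun _ => 0)
      (((L.br.flip.continuous.comp_continuousOn hMμ).clm_comp continuousOn_const).add
        (L.br.continuous.comp_continuousOn (p.continuous.comp_continuousOn hMν))) ht₀
      (fun t ht => ((lax μ hμ hMμ t ht).sub (lax ν hν hMν t ht)).congr_deriv (by simp))
      (fun t ht => (hasDerivWithinAt_const t _ _).congr_deriv (by simp)) (by simp [h₀])
    exact fun t ht => sub_eq_zero.1 (h1 ht)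
  refine linearODE_unique (A := fun t => A (p (diffAt B H (μ t))))
    (A.continuous.comp_continuousOn (p.continuous.comp_continuousOn hMμ)) ht₀ hμ
    (fun t ht => ?_) h₀
  have e : diffAt B H (μ t) = diffAt B H (ν t) := hM ht
  rw [e]
  exact hν t ht

end LiePoissonFlow

/-! ### Coadjoint orbits and Lie subgroups -/

section CoadjointOrbits

open Filter Topology

variable {𝔤 : Type*} [NormedAddCommGroup 𝔤] [NormedSpace ℝ 𝔤]
  {𝔟 : Type*} [NormedAddCommGroup 𝔟] [NormedSpace ℝ 𝔟]
  {B : 𝔟 →L[ℝ] 𝔤 →L[ℝ] ℝ} {L : BanachLieBracket 𝔤} {A : 𝔤 →L[ℝ] 𝔟 →L[ℝ] 𝔟} {H : 𝔟 → ℝ}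
  {E : Type*} [NormedAddCommGroup E] [NormedSpace ℝ E]
  {G : Type*} [TopologicalSpace G] [ChartedSpace E G] [Group G]

/-- The identification of `𝔤` with the Lie algebra of `G`, with the model space of `G` as target. -/
def modelEquiv (φ : 𝔤 ≃L[ℝ] GroupLieAlgebra 𝓘(ℝ, E) G) : 𝔤 ≃L[ℝ] E := φ

variable {φ : 𝔤 ≃L[ℝ] GroupLieAlgebra 𝓘(ℝ, E) G}

variable [LieGroup 𝓘(ℝ, E) ∞ G]

theorem Ad_apply (g : G) (y : 𝔤) :
    Ad φ g y = (modelEquiv φ).symm (chartAd g (modelEquiv φ y)) :=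
  congrArg (modelEquiv φ).symm (adjointAction_apply_eq_chartAd g (modelEquiv φ y))

theorem IsLieAlgebraIso.modelEquiv_br (hφ : IsLieAlgebraIso L φ) (x y : 𝔤) :
    modelEquiv φ (L.br x y) = chartBracket G (modelEquiv φ x) (modelEquiv φ y) :=
  (hφ x y).trans (bracket_eq_chartBracket _ _)

theorem Ad_one_apply (y : 𝔤) : Ad φ (1 : G) y = y := by
  rw [Ad_apply, chartAd_one, ContinuousLinearMap.id_apply, ContinuousLinearEquiv.symm_apply_apply]

theorem Ad_mul_apply (g h : G) (y : 𝔤) : Ad φ (g * h) y = Ad φ g (Ad φ h y) := by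
  simp only [Ad_apply, chartAd_mul, ContinuousLinearMap.comp_apply,
    ContinuousLinearEquiv.apply_symm_apply]

/-- The adjoint action along a curve in the group with right velocity `a` solves `w' = [a, w]`. -/
theorem HasRightVelocity.hasDerivAt_Ad (hφ : IsLieAlgebraIso L φ) {γ : ℝ → G} {a : 𝔤} {t : ℝ}
    (h : HasRightVelocity γ (modelEquiv φ a) t) (y : 𝔤) :
    HasDerivAt (fun s => Ad φ (γ s) y) (L.br a (Ad φ (γ t) y)) t := by
  have h1 := (modelEquiv φ).symm.hasFDerivAt.comp_hasDerivAt t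
    (h.hasDerivAt_chartAd (modelEquiv φ y))
  refine (h1.congr_deriv ?_).congr_of_eventuallyEq (Eventually.of_forall fun s => Ad_apply _ _)
  rw [← (modelEquiv φ).symm_apply_apply (L.br a _), hφ.modelEquiv_br, Ad_apply,
    ContinuousLinearEquiv.apply_symm_apply]
  rfl

/-- The coadjoint action of `G` along a curve through the identity preserves `𝔟` and is there
given by the coadjoint flow of the right velocity. -/
theorem IsCoadjointFlow.eq_coAd {a : ℝ → 𝔤} {α β t₀ : ℝ} {U : ℝ → 𝔟 →L[ℝ] 𝔟}
    (hU : IsCoadjointFlow A a α β t₀ U) (hA : IsCoadjointOperator B L A)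
    (hφ : IsLieAlgebraIso L φ) (ht₀ : t₀ ∈ Icc α β) {γ : ℝ → G} (hγ₀ : γ t₀ = 1)
    (hγ : ∀ t ∈ Icc α β, HasRightVelocity γ (modelEquiv φ (a t)) t) (x : 𝔟) {t : ℝ}
    (ht : t ∈ Icc α β) : B (U t x) = coAd φ (γ t) (B x) := by
  ext y
  have := hU.pairing_eq hA ht₀ (w := fun s => Ad φ (γ s) (Ad φ (γ t)⁻¹ y))
    (fun s hs => ((hγ s hs).hasDerivAt_Ad hφ _).hasDerivWithinAt) x ht
  rw [← Ad_mul_apply, mul_inv_cancel, Ad_one_apply, hγ₀, Ad_one_apply] at this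
  exact this

/-- An `Ad*_G`-invariant function is infinitesimally invariant: differentiate it along the
coadjoint flow of a one-parameter subgroup. -/
theorem IsCoAdInvariant.isInfinitesimallyInvariant [CompleteSpace E] [CompleteSpace 𝔟]
    (hinv : IsCoAdInvariant B φ H) (hφ : IsLieAlgebraIso L φ) (hA : IsCoadjointOperator B L A)
    (hH : H ∈ admissibleFunctions B) : IsInfinitesimallyInvariant B L H := by
  intro x X
  have h0 : (0 : ℝ) ∈ Icc (-1 : ℝ) 1 := by norm_num
  obtain ⟨U, hU⟩ := exists_isCoadjointFlow A (a := fun _ => X) continuousOn_const h0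
  have hconst : ∀ t ∈ Icc (-1 : ℝ) 1, H (U t x) = H x := fun t ht =>
    hinv _ x _ (hU.eq_coAd hA hφ h0 (lieExp_zero_smul (G := G) (modelEquiv φ X))
      (fun s _ => hasRightVelocity_lieExp (modelEquiv φ X) s) x ht)
  have hnhds : Icc (-1 : ℝ) 1 ∈ 𝓝 (0 : ℝ) := Icc_mem_nhds (by norm_num) (by norm_num)
  have h1 := (hasFDerivAt_of_mem_admissibleFunctions hH (U 0 x)).comp_hasDerivAt (0 : ℝ)
    ((hU.deriv 0 h0 x).hasDerivAt hnhds)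
  have h2 : HasDerivAt (H ∘ fun s => U s x) 0 0 :=
    (hasDerivAt_const (0 : ℝ) (H x)).congr_of_eventuallyEq (by
      filter_upwards [hnhds] with t ht using hconst t ht)
  have h3 := h1.unique h2
  rw [ContinuousLinearMap.flip_apply, hA, hU.init, ContinuousLinearMap.id_apply] at h3
  exact neg_eq_zero.1 h3

/-- The one-parameter subgroup with velocity a multiple of `D_x H` fixes `x`. -/
theorem IsInfinitesimallyInvariant.apply_Ad_lieExp [CompleteSpace E]
    (hinf : IsInfinitesimallyInvariant B L H) (hφ : IsLieAlgebraIso L φ) (x : 𝔟) (t : ℝ) (y : 𝔤) :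
    B x (Ad φ (lieExp (t • -φ (diffAt B H x)))⁻¹ y) = B x y := by
  set γ : ℝ → G := fun s => lieExp (s • -φ (diffAt B H x))
  have hγ : ∀ s, HasRightVelocity γ (modelEquiv φ (-diffAt B H x)) s := fun s => by
    rw [map_neg]
    exact hasRightVelocity_lieExp _ s
  have hγ0 : γ 0 = 1 := lieExp_zero_smul (-modelEquiv φ (diffAt B H x))
  set z := Ad φ (γ t)⁻¹ y with hz
  have hd : ∀ s, HasDerivAt (fun s => B x (Ad φ (γ s) z)) 0 s := fun s => by
    refine ((B x).hasFDerivAt.comp_hasDerivAt s ((hγ s).hasDerivAt_Ad hφ z)).congr_deriv ?_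
    simp [hinf.apply_left]
  have := is_const_of_deriv_eq_zero (fun s => (hd s).differentiableAt) (fun s => (hd s).deriv) t 0
  rw [hγ0, Ad_one_apply, hz, ← Ad_mul_apply, mul_inv_cancel, Ad_one_apply] at this
  exact this.symm

end CoadjointOrbits

section Subgroups

variable {𝔤 : Type*} [NormedAddCommGroup 𝔤] [NormedSpace ℝ 𝔤]
  {E : Type*} [NormedAddCommGroup E] [NormedSpace ℝ E]
  {G : Type*} [TopologicalSpace G] [ChartedSpace E G] [Group G]
  {φ : 𝔤 ≃L[ℝ] GroupLieAlgebra 𝓘(ℝ, E) G} {𝔥 : Submodule ℝ 𝔤}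
  {E' : Type*} [NormedAddCommGroup E'] [NormedSpace ℝ E']
  {K : Type*} [TopologicalSpace K] [ChartedSpace E' K] [Group K] {ι : K →* G}

/-- The derivative at the identity of the inclusion of a Lie subgroup, as a bounded operator between
the model spaces instead of the tangent spaces. -/
theorem IsLieSubgroup.exists_deriv (h : IsLieSubgroup φ 𝔥 E' ι) :
    ∃ D : E' →L[ℝ] E, D = mfderiv 𝓘(ℝ, E') 𝓘(ℝ, E) ι 1 ∧ Function.Injective D ∧
      (∀ v, (modelEquiv φ).symm (D v) ∈ 𝔥) ∧ ∀ x ∈ 𝔥, ∃ v, D v = modelEquiv φ x := by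
  have hr : Set.range (mfderiv 𝓘(ℝ, E') 𝓘(ℝ, E) ι 1 : E' → E) = modelEquiv φ '' 𝔥 := h.range
  refine ⟨mfderiv 𝓘(ℝ, E') 𝓘(ℝ, E) ι 1, rfl, h.immersion, fun v => ?_, fun x hx => ?_⟩
  · obtain ⟨x, hx, hxv⟩ := hr.subset ⟨v, rfl⟩
    have hx' : (modelEquiv φ).symm (mfderiv 𝓘(ℝ, E') 𝓘(ℝ, E) ι 1 v : E) = x :=
      (modelEquiv φ).symm_apply_eq.2 hxv.symm
    exact hx'.symm ▸ hx
  · exact hr.superset ⟨x, hx, rfl⟩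

theorem bijective_coprod_of_isSplitting {L : BanachLieBracket 𝔤} {𝔤p 𝔤m : Submodule ℝ 𝔤}
    (hL : L.IsSplitting 𝔤p 𝔤m) (ψ : 𝔤 ≃L[ℝ] E) {E₁ E₂ : Type*}
    [NormedAddCommGroup E₁] [NormedSpace ℝ E₁] [NormedAddCommGroup E₂] [NormedSpace ℝ E₂]
    {D₁ : E₁ →L[ℝ] E} {D₂ : E₂ →L[ℝ] E} (hi₁ : Function.Injective D₁) (hi₂ : Function.Injective D₂)
    (hm₁ : ∀ v, ψ.symm (D₁ v) ∈ 𝔤p) (hm₂ : ∀ v, ψ.symm (D₂ v) ∈ 𝔤m)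
    (hs₁ : ∀ x ∈ 𝔤p, ∃ v, D₁ v = ψ x) (hs₂ : ∀ x ∈ 𝔤m, ∃ v, D₂ v = ψ x) :
    Function.Bijective (D₁.coprod D₂) := by
  constructor
  · rw [injective_iff_map_eq_zero]
    rintro ⟨v, w⟩ h
    rw [ContinuousLinearMap.coprod_apply] at h
    have e : ψ.symm (D₁ v) = ψ.symm (D₂ (-w)) := by
      rw [map_neg, eq_neg_of_add_eq_zero_left h]
    have h0 := Submodule.disjoint_def.1 hL.compl.isCompl.disjoint _ (hm₁ v) (e ▸ hm₂ (-w))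
    have hv : v = 0 := hi₁ (by rw [map_zero]; simpa using h0)
    have hw : w = 0 := hi₂ (by rw [hv, map_zero, zero_add] at h; rw [h, map_zero])
    rw [hv, hw]; rfl
  · intro z
    obtain ⟨x, hx, y, hy, hxy⟩ := Submodule.mem_sup.1
      (hL.compl.isCompl.sup_eq_top ▸ Submodule.mem_top : ψ.symm z ∈ 𝔤p ⊔ 𝔤m)
    obtain ⟨v, hv⟩ := hs₁ x hx
    obtain ⟨w, hw⟩ := hs₂ y hy
    exact ⟨(v, w), by rw [ContinuousLinearMap.coprod_apply, hv, hw, ← map_add, hxy,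
      ContinuousLinearEquiv.apply_symm_apply]⟩

end Subgroups

theorem exists_Icc_subset_of_ordConnected {J : Set ℝ} (hJ : IsOpen J) (hc : J.OrdConnected)
    {s t : ℝ} (hs : s ∈ J) (ht : t ∈ J) :
    ∃ α β, Icc α β ⊆ J ∧ s ∈ Ioo α β ∧ t ∈ Ioo α β := by
  have hmin : min s t ∈ J := by rcases min_choice s t with h | h <;> rwa [h]
  have hmax : max s t ∈ J := by rcases max_choice s t with h | h <;> rwa [h]
  obtain ⟨δ, hδ, h1⟩ := Metric.isOpen_iff.1 hJ _ hmin
  obtain ⟨η, hη, h2⟩ := Metric.isOpen_iff.1 hJ _ hmax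
  rw [Real.ball_eq_Ioo] at h1 h2
  refine ⟨min s t - δ / 2, max s t + η / 2,
    hc.out (h1 ⟨by linarith, by linarith⟩) (h2 ⟨by linarith, by linarith⟩), ?_, ?_⟩ <;>
  constructor <;>
  linarith [min_le_left s t, min_le_right s t, le_max_left s t, le_max_right s t]

end

/-! ### Factorization and integral curves -/

theorem mainTheorem1
    {𝔤 𝔟 : Type*}
    [NormedAddCommGroup 𝔤] [NormedSpace ℝ 𝔤] [CompleteSpace 𝔤]
    [NormedAddCommGroup 𝔟] [NormedSpace ℝ 𝔟] [CompleteSpace 𝔟]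
    (L : BanachLieBracket 𝔤) (𝔤p 𝔤m : Submodule ℝ 𝔤) (hL : L.IsSplitting 𝔤p 𝔤m)
    (B : 𝔟 →L[ℝ] 𝔤 →L[ℝ] ℝ)
    (hB : IsBanachLiePoisson B L)
    (hBR : IsBanachLiePoisson B (L.withR hL.R hL.isRMatrix))
    {E G : Type*} [NormedAddCommGroup E] [NormedSpace ℝ E] [CompleteSpace E]
    [TopologicalSpace G] [ChartedSpace E G] [Group G] [LieGroup 𝓘(ℝ, E) ∞ G]
    {Ep Gp : Type*} [NormedAddCommGroup Ep] [NormedSpace ℝ Ep] [CompleteSpace Ep]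
    [TopologicalSpace Gp] [ChartedSpace Ep Gp] [Group Gp] [LieGroup 𝓘(ℝ, Ep) ∞ Gp]
    {Em Gm : Type*} [NormedAddCommGroup Em] [NormedSpace ℝ Em] [CompleteSpace Em]
    [TopologicalSpace Gm] [ChartedSpace Em Gm] [Group Gm] [LieGroup 𝓘(ℝ, Em) ∞ Gm]
    (φ : 𝔤 ≃L[ℝ] GroupLieAlgebra 𝓘(ℝ, E) G) (hφ : IsLieAlgebraIso L φ)
    (ιp : Gp →* G) (hιp : IsLieSubgroup φ 𝔤p Ep ιp)
    (ιm : Gm →* G) (hιm : IsLieSubgroup φ 𝔤m Em ιm)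
    (H : 𝔟 → ℝ) (hH : H ∈ admissibleFunctions B) (hinv : IsCoAdInvariant B φ H)
    (μ₀ : 𝔟) :
    -- the factorization problem is solvable on some interval around the origin
    (∃ ε > 0, ∃ (gp : ℝ → Gp) (gm : ℝ → Gm),
      IsFactorization Ep Em ιp ιm (-φ (diffAt B H μ₀)) (Ioo (-ε) ε) gp gm) ∧
    -- every solution, on any open interval around the origin, gives the integral curve
    (∀ (J : Set ℝ) (gp : ℝ → Gp) (gm : ℝ → Gm), IsOpen J → J.OrdConnected → 0 ∈ J →
      IsFactorization Ep Em ιp ιm (-φ (diffAt B H μ₀)) J gp gm →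
      ∃ μ : ℝ → 𝔟,
        μ 0 = μ₀ ∧
        IsIntegralCurveOn μ (fun _ => hamiltonianField B (L.withR hL.R hL.isRMatrix) H) J ∧
        (∀ t ∈ J, B (μ t) = coAd φ (ιp (gp t)) (B μ₀)) ∧
        (∀ t ∈ J, B (μ t) = coAd φ (ιm (gm t)) (B μ₀)) ∧
        -- uniqueness, among the integral curves along which `D H` is continuous into `𝔤`
        (ContinuousOn (fun t => diffAt B H (μ t)) J ∧
          ∀ ν : ℝ → 𝔟, ν 0 = μ₀ →
            IsIntegralCurveOn ν (fun _ => hamiltonianField B (L.withR hL.R hL.isRMatrix) H) J →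
            ContinuousOn (fun t => diffAt B H (ν t)) J → EqOn ν μ J)) := by
  obtain ⟨Dp, hDp, hip, hmp, hsp⟩ := hιp.exists_deriv
  obtain ⟨Dm, hDm, him, hmm, hsm⟩ := hιm.exists_deriv
  refine ⟨exists_isFactorization hιp.smooth hιm.smooth hDp hDm
    (bijective_coprod_of_isSplitting hL (modelEquiv φ) hip him hmp hmm hsp hsm) _, ?_⟩
  intro J gp gm hJ hJc h0J hfac
  obtain ⟨A, hA⟩ := hB.exists_isCoadjointOperator
  have hinf := hinv.isInfinitesimallyInvariant hφ hA hH
  set ξ := diffAt B H μ₀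
  -- the right velocities of the two factors
  obtain ⟨a', ha'c, ha'⟩ := hfac.smooth_pos.exists_hasRightVelocity hJ
  obtain ⟨b', -, hb'⟩ := hfac.smooth_neg.exists_hasRightVelocity hJ
  let a : ℝ → 𝔤 := fun t => (modelEquiv φ).symm (Dp (a' t))
  let b : ℝ → 𝔤 := fun t => (modelEquiv φ).symm (Dm (b' t))
  have ha (t : ℝ) (ht : t ∈ J) :
      HasRightVelocity (fun s => ιp (gp s)) (modelEquiv φ (a t)) t := by
    rw [ContinuousLinearEquiv.apply_symm_apply]; exact (ha' t ht).map hιp.smooth hDp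
  have hb (t : ℝ) (ht : t ∈ J) :
      HasRightVelocity (fun s => ιm (gm s)) (modelEquiv φ (b t)) t := by
    rw [ContinuousLinearEquiv.apply_symm_apply]; exact (hb' t ht).map hιm.smooth hDm
  have hac : ContinuousOn a J :=
    (modelEquiv φ).symm.continuous.comp_continuousOn (Dp.continuous.comp_continuousOn ha'c)
  have hγ0 : ιp (gp 0) = 1 := by rw [hfac.init_pos, map_one]
  have hgm (t : ℝ) (ht : t ∈ J) : ιm (gm t) = ιp (gp t) * lieExp (t • -φ ξ) := by
    rw [hfac.factor t ht, mul_inv_cancel_left]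
  -- differentiating the factorization: `Ad_{g₊} ξ = a - b`
  have hab (t : ℝ) (ht : t ∈ J) : Ad φ (ιp (gp t)) ξ = a t - b t := by
    have h1 := (ha t ht).mul (hasRightVelocity_lieExp (G := G) (-modelEquiv φ ξ) t)
    have h2 := (hb t ht).unique (h1.congr_of_eventuallyEq (by
      filter_upwards [hJ.mem_nhds ht] with s hs using hgm s hs))
    rw [Ad_apply, ← (modelEquiv φ).injective.eq_iff, ContinuousLinearEquiv.apply_symm_apply,
      map_sub, h2, map_neg]
    abel
  have hpa (t : ℝ) (ht : t ∈ J) :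
      𝔤p.projectionL 𝔤m hL.compl (Ad φ (ιp (gp t)) ξ) = a t := by
    rw [hab t ht, map_sub, Submodule.projectionL_apply_left hL.compl ⟨a t, hmp _⟩,
      Submodule.projectionL_apply_right hL.compl ⟨b t, hmm _⟩, sub_zero]
  -- on compact subintervals, the coadjoint orbit of `μ₀` stays in `𝔟`
  have local_flow (α β : ℝ) (hαβ : Icc α β ⊆ J) (h0 : (0 : ℝ) ∈ Icc α β) :
      ∃ U, IsCoadjointFlow A a α β 0 U ∧
        (∀ s ∈ Icc α β, B (U s μ₀) = coAd φ (ιp (gp s)) (B μ₀)) ∧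
        ∀ s ∈ Icc α β, diffAt B H (U s μ₀) = Ad φ (ιp (gp s)) ξ := by
    obtain ⟨U, hU⟩ := exists_isCoadjointFlow A (hac.mono hαβ) h0
    refine ⟨U, hU, fun s hs => hU.eq_coAd hA hφ h0 hγ0 (fun r hr => ha r (hαβ hr)) μ₀ hs,
      fun s hs => hU.diffAt_eq hB.pairing hA h0 hH hinf μ₀ (w := fun s => Ad φ (ιp (gp s)) ξ)
        (fun r hr => ((ha r (hαβ hr)).hasDerivAt_Ad hφ ξ).hasDerivWithinAt)
        (by rw [hγ0, Ad_one_apply]) hs⟩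
  have hex : ∀ t, ∃ ν : 𝔟, t ∈ J → B ν = coAd φ (ιp (gp t)) (B μ₀) := fun t => by
    by_cases ht : t ∈ J
    · obtain ⟨α, β, hαβ, h0, htI⟩ := exists_Icc_subset_of_ordConnected hJ hJc h0J ht
      obtain ⟨U, -, hU, -⟩ := local_flow α β hαβ (Ioo_subset_Icc_self h0)
      exact ⟨U t μ₀, fun _ => hU t (Ioo_subset_Icc_self htI)⟩
    · exact ⟨0, fun h => absurd h ht⟩
  -- outside `J` the value of `μ` is arbitrary
  choose μ hμ using hex
  have hμU {α β : ℝ} {U : ℝ → 𝔟 →L[ℝ] 𝔟} (hαβ : Icc α β ⊆ J)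
      (hU : ∀ s ∈ Icc α β, B (U s μ₀) = coAd φ (ιp (gp s)) (B μ₀)) :
      ∀ s ∈ Icc α β, μ s = U s μ₀ := fun s hs =>
    hB.pairing.injective_left ((hμ s (hαβ hs)).trans (hU s hs).symm)
  have hM : ∀ t ∈ J, diffAt B H (μ t) = Ad φ (ιp (gp t)) ξ := fun t ht => by
    obtain ⟨α, β, hαβ, h0, htI⟩ := exists_Icc_subset_of_ordConnected hJ hJc h0J ht
    obtain ⟨U, -, hU, hd⟩ := local_flow α β hαβ (Ioo_subset_Icc_self h0)
    rw [hμU hαβ hU t (Ioo_subset_Icc_self htI), hd t (Ioo_subset_Icc_self htI)]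
  have hMc : ContinuousOn (fun t => diffAt B H (μ t)) J :=
    ContinuousOn.congr
      (fun t ht => ((ha t ht).hasDerivAt_Ad hφ ξ).continuousAt.continuousWithinAt) hM
  have hμ0 : μ 0 = μ₀ := hB.pairing.injective_left (by
    ext y
    rw [hμ 0 h0J, hγ0, coAd, inv_one, ContinuousLinearMap.comp_apply, Ad_one_apply])
  have hint : IsIntegralCurveOn μ
      (fun _ => hamiltonianField B (L.withR hL.R hL.isRMatrix) H) J := fun t ht => by
    obtain ⟨α, β, hαβ, h0, htI⟩ := exists_Icc_subset_of_ordConnected hJ hJc h0J ht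
    obtain ⟨U, hUf, hU, -⟩ := local_flow α β hαβ (Ioo_subset_Icc_self h0)
    have htI' := Ioo_subset_Icc_self htI
    change HasDerivWithinAt μ (hamiltonianField B (L.withR hL.R hL.isRMatrix) H (μ t)) J t
    rw [hamiltonianField_withR hL hBR hA hinf, hM t ht, hpa t ht, hμU hαβ hU t htI']
    exact (((hUf.deriv t htI' μ₀).congr (hμU hαβ hU) (hμU hαβ hU t htI')).hasDerivAt
      (Icc_mem_nhds htI.1 htI.2)).hasDerivWithinAt
  refine ⟨μ, hμ0, hint, fun t ht => hμ t ht, fun t ht => ?_, hMc, fun ν hν0 hν hMν t ht => ?_⟩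
  -- the two orbits coincide because `exp (-t ξ)` fixes `μ₀`
  · rw [hμ t ht, hgm t ht]
    ext y
    rw [coAd, coAd, ContinuousLinearMap.comp_apply, ContinuousLinearMap.comp_apply, mul_inv_rev,
      Ad_mul_apply, hinf.apply_Ad_lieExp hφ]
  · obtain ⟨α, β, hαβ, h0, htI⟩ := exists_Icc_subset_of_ordConnected hJ hJc h0J ht
    have hode {κ : ℝ → 𝔟} (hκ : IsIntegralCurveOn κ
        (fun _ => hamiltonianField B (L.withR hL.R hL.isRMatrix) H) J) :
        ∀ s ∈ Icc α β, HasDerivWithinAt κ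
          (A (𝔤p.projectionL 𝔤m hL.compl (diffAt B H (κ s))) (κ s)) (Icc α β) s := fun s hs => by
      rw [← hamiltonianField_withR hL hBR hA hinf]
      exact (hκ s (hαβ hs)).mono hαβ
    exact eqOn_of_hasDerivWithinAt hB.pairing hA hH hinf (𝔤p.projectionL 𝔤m hL.compl)
      (Ioo_subset_Icc_self h0) (hν0.trans hμ0.symm) (hode hν) (hode hint) (hMν.mono hαβ)
      (hMc.mono hαβ) (Ioo_subset_Icc_self htI)
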